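/- Let $(M,g)$ be a complete, non-compact Riemannian manifold with $\dim M\ge 2$, with volume measure $dV$; write $|A|$ for the volume of $A$. Let $\rho\ge 0$ be a locally Lipschitz continuous function on $M$ such that $|\nabla\rho|\le 1$ a.e. and such that $B_r:=\{\rho<r\}$ is relatively compact for every $r>0$. For a relatively compact open set $\Omega\subset M$ let $$\lambda_1(\Omega)=\inf\left\{\frac{\int_\Omega|\nabla\phi|^2\,dV}{\int_\Omega\phi^2\,dV}:\ \phi \text{ Lipschitz on } M \text{ with compact support},\ \operatorname{supp}\phi\subset\overline\Omega,\ \phi\not\equiv0\right\}$$ (with $\lambda_1(\varnothing)=+\infty$), and put $$\Lambda_*:=\liminf_{r\to+\infty} r^2\lambda_1(B_r)\in[0,+\infty],\qquad \nu_*:=\liminf_{r\to+\infty}\frac{\log|B_r|}{\log r}\in[-\infty,+\infty].$$ For $\mu\ge0$ let $$\lambda_\mu=\inf\left\{\frac{\int_0^1|\psi'(s)|^2s^{\mu-1}\,ds}{\int_0^1|\psi(s)|^2s^{\mu-1}\,ds}:\ \psi\in\mathrm{Lip}([0,1]),\ \psi(1)=0,\ \psi\not\equiv0\right\}$$ (for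 $\mu=0$ a quotient with infinite denominator counts as $0$, so $\lambda_0=0$), and for $\nu>-1$ let $j_\nu$ be the first positive zero of the Bessel function $J_\nu$. Then $\nu_*\ge0$, and if $\nu_*<+\infty$, $$\Lambda_*\le\lambda_{\nu_*},\qquad\text{and}\qquad \lambda_{\nu_*}=j_{\nu_*/2-1}^2\ \text{ if }\nu_*>0.$$ Moreover there are constants $\varepsilon,N,C_1,C_2>0$, independent of $M$ (and of its dimension) and of $\rho$, such that 1. $\Lambda_*=0$ if $\nu_*=0$; 2. $\Lambda_*\le C_1\nu_*$ if $0<\nu_*<\varepsilon$; 3. $\Lambda_*\le C_2\nu_*^2$ if $N<\nu_*<+\infty$. -/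

import Mathlib

open MeasureTheory Filter Topology Bundle Manifold
open scoped ENNReal ContDiff

noncomputable section

section Manifold

variable (E : Type*) [NormedAddCommGroup E] [InnerProductSpace ℝ E]
  {M : Type*} [EMetricSpace M] [ChartedSpace E M]
  [RiemannianBundle (fun x : M ↦ TangentSpace 𝓘(ℝ, E) x)]

/-- The matrix `g_ij(y)` of the Riemannian metric in the preferred chart around `p`, at the point
`y` of the target of the chart, with respect to orthonormal linear coordinates on the model
space `E`. -/
def metricMatrix [FiniteDimensional ℝ E] (p : M) (y : E) :
    Matrix (Fin (Module.finrank ℝ E)) (Fin (Module.finrank ℝ E)) ℝ :=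
  Matrix.of fun i j ↦
    inner ℝ
      (mfderiv 𝓘(ℝ, E) 𝓘(ℝ, E) (extChartAt 𝓘(ℝ, E) p).symm y (stdOrthonormalBasis ℝ E i))
      (mfderiv 𝓘(ℝ, E) 𝓘(ℝ, E) (extChartAt 𝓘(ℝ, E) p).symm y (stdOrthonormalBasis ℝ E j))

variable [FiniteDimensional ℝ E] [MeasurableSpace E] [BorelSpace E] [MeasurableSpace M]

/-- The measure `√(det g) dy` of the preferred chart around `p`, transported to `M`. -/
def chartVolume (p : M) : Measure M :=
  (((volume : Measure E).restrict (extChartAt 𝓘(ℝ, E) p).target).withDensity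
    (fun y ↦ ENNReal.ofReal (Real.sqrt (metricMatrix E p y).det))).map
      (extChartAt 𝓘(ℝ, E) p).symm

variable (M) in
/-- The Riemannian volume measure `dV`. By the change of variables formula the measures
`√(det g) dy` of two charts agree on the overlap of their domains. The volume is the measure
on `M` which restricts to them; since countably many chart domains cover a (σ-compact) manifold,
this is the least measure that dominates all of them. -/
def riemannianVolume : Measure M :=
  ⨆ p : M, chartVolume E p

/-- `|∇ f|` at `x`: the norm of the differential of `f` with respect to the Riemannian metric.
It is only used for locally Lipschitz `f`, which are differentiable almost everywhere. -/
def gradNorm (f : M → ℝ) (x : M) : ℝ :=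
  norm (E := TangentSpace 𝓘(ℝ, E) x →L[ℝ] ℝ) (mfderiv 𝓘(ℝ, E) 𝓘(ℝ, ℝ) f x)

/-- The first Dirichlet eigenvalue `λ₁(Ω)`: the infimum of the Rayleigh quotients of the nonzero
compactly supported Lipschitz functions with support in the closure of `Ω`. It is `∞` for
`Ω = ∅`. -/
def dirichletEigenvalue (Ω : Set M) : ℝ≥0∞ :=
  ⨅ φ ∈ {φ : M → ℝ | (∃ K, LipschitzWith K φ) ∧ HasCompactSupport φ ∧
      tsupport φ ⊆ closure Ω ∧ φ ≠ 0},
    (∫⁻ x in Ω, ENNReal.ofReal (gradNorm E φ x ^ 2) ∂(riemannianVolume E M)) /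
      (∫⁻ x in Ω, ENNReal.ofReal (φ x ^ 2) ∂(riemannianVolume E M))

/-- `ρ` is a nonnegative locally Lipschitz exhaustion function with `|∇ρ| ≤ 1` almost
everywhere. -/
structure IsLipschitzExhaustion (ρ : M → ℝ) : Prop where
  nonneg : ∀ x, 0 ≤ ρ x
  locallyLipschitz : LocallyLipschitz ρ
  isCompact_closure : ∀ r : ℝ, 0 < r → IsCompact (closure {x | ρ x < r})
  gradNorm_le_one : ∀ᵐ x ∂(riemannianVolume E M), gradNorm E ρ x ≤ 1

/-- `Λ_* = liminf_{r → ∞} r² λ₁(B_r)` with `B_r = {ρ < r}`. -/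
def LambdaStar (ρ : M → ℝ) : ℝ≥0∞ :=
  liminf (fun r : ℝ ↦ ENNReal.ofReal (r ^ 2) * dirichletEigenvalue E {x | ρ x < r}) atTop

/-- `ν_* = liminf_{r → ∞} log |B_r| / log r` with `B_r = {ρ < r}`. -/
def nuStar (ρ : M → ℝ) : EReal :=
  liminf (fun r : ℝ ↦
    ENNReal.log (riemannianVolume E M {x | ρ x < r}) / ((Real.log r : ℝ) : EReal)) atTop

end Manifold

/-- `λ_μ`: the first eigenvalue on `[0, 1)` for the measure `s ^ (μ - 1) ds` and the Dirichlet
condition at `s = 1`. For `μ > 0` both integrals are finite and the denominator is positive.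
For `μ = 0` the denominator is `∞` when `ψ 0 ≠ 0`, and the value is `0`. -/
def radialEigenvalue (μ : ℝ) : ℝ≥0∞ :=
  ⨅ ψ ∈ {ψ : ℝ → ℝ | (∃ K, LipschitzOnWith K ψ (Set.Icc 0 1)) ∧ ψ 1 = 0 ∧
      ∃ s ∈ Set.Icc (0 : ℝ) 1, ψ s ≠ 0},
    (∫⁻ s in Set.Ioo (0 : ℝ) 1, ENNReal.ofReal (deriv ψ s ^ 2 * s ^ (μ - 1))) /
      (∫⁻ s in Set.Ioo (0 : ℝ) 1, ENNReal.ofReal (ψ s ^ 2 * s ^ (μ - 1)))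

/-- The Bessel function `J_ν(t)` of the first kind, for `ν > -1` and `t > 0`. -/
def besselJ (ν t : ℝ) : ℝ :=
  ∑' m : ℕ, (-1) ^ m / ((m.factorial : ℝ) * Real.Gamma ((m : ℝ) + ν + 1)) *
    (t / 2) ^ (2 * (m : ℝ) + ν)

/-- The first positive zero `j_ν` of `J_ν`. -/
def besselFirstZero (ν : ℝ) : ℝ :=
  sInf {t : ℝ | 0 < t ∧ besselJ ν t = 0}

end

/-! Let `m` be the distribution of `ρ` and V(r) = m(`Iio r`) = |B_r|. If Λ < Λ_*, then for all large
r the test function ψ(ρ/r) turns the eigenvalue bound into the one-dimensional inequality Λ ∫_{t<r}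
ψ(t/r)² dm ≤ ∫_{t<r} ψ'(t/r)² dm (`dirichletEigenvalue_mul_lintegral_le`). The geometry of M enters
only here and through the positivity of the volume of nonempty open sets.

Multiply by r^(-μ-1) and integrate over a < r < R. By Tonelli and the substitution s = t/r, each
side becomes, up to truncation, the moment F(R) = ∫_{a≤t<R} t^(-μ) dm times the integral of ψ² or
ψ'² against s^(μ-1) (`mellin_moment_recursion`). If Λ > λ_ν and ψ is extremal for λ_ν, then for μ
slightly below ν this yields F(R) ≥ q F(δR) for large R, with q > 1 and δ < 1 independent of μ.
Iteration gives F(R) ≥ c R^κ with δ^κ = 1/q, hence V(R) ≥ c' R^(μ+κ). Taking μ within κ/2 of ν makes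
the exponent exceed ν, contradicting ν_* = ν (`exists_growth_of_integral_lt`). For ν = 0 there is no
room for μ in (0, ν); there 1 - s² tested at a single scale already gives V(R) ≥ q V(δR), so
polynomial growth (`exists_growth_of_pos`).

The extremal is a multiple of s^(1-ν/2) J_{ν/2-1}(js). Its differential equation gives it the
quotient j², and Picone's inequality with τ < j gives the reverse bound (`radialEigenvalue_eq`). The
constants need no asymptotics of Bessel zeros: 1 - s² has quotient ν(ν+4)/2, which is at most 5ν/2
for ν ≤ 1 and at most 5ν²/2 for ν ≥ 1 (`radialEigenvalue_le_quadratic`). -/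

/-! ### Bessel functions as entire functions of t²/4. -/

/-- The coefficients of the entire function `besselEntire a`. -/
noncomputable def besselCoeff (a : ℝ) (m : ℕ) : ℝ :=
  (-1) ^ m / ((m.factorial : ℝ) * Real.Gamma ((m : ℝ) + a))

/-- The entire function `∑ (-1) ^ m x ^ m / (m! Γ(m + a))`, so that
`J_{a - 1}(t) = (t / 2) ^ (a - 1) * besselEntire a (t ^ 2 / 4)`. -/
noncomputable def besselEntire (a x : ℝ) : ℝ :=
  ∑' m : ℕ, besselCoeff a m * x ^ m

lemma besselCoeff_ne_zero {a : ℝ} (ha : 0 < a) (m : ℕ) : besselCoeff a m ≠ 0 := by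
  have := Real.Gamma_pos_of_pos (show (0 : ℝ) < m + a by positivity)
  unfold besselCoeff
  positivity

/-- Because (m+1)! = (m+1) m!, a shift of the index is a shift of the parameter; this is why
differentiation raises `a` by one. -/
lemma besselCoeff_succ (a : ℝ) (m : ℕ) :
    besselCoeff a (m + 1) * (m + 1) = -besselCoeff (a + 1) m := by
  unfold besselCoeff
  rw [Nat.factorial_succ]
  push_cast
  rw [show (m : ℝ) + 1 + a = m + (a + 1) by ring, pow_succ]
  have : (m : ℝ) + 1 ≠ 0 := by positivity
  rw [mul_assoc, ← mul_div_mul_left _ ((m.factorial : ℝ) * _) this]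
  ring

lemma besselCoeff_eq_mul {a : ℝ} (ha : 0 < a) (m : ℕ) :
    besselCoeff a m = (a + m) * besselCoeff (a + 1) m := by
  unfold besselCoeff
  have hp : (0 : ℝ) < m + a := by positivity
  have h := Real.Gamma_pos_of_pos hp
  rw [← add_assoc, Real.Gamma_add_one hp.ne']
  field_simp
  ring

lemma summable_norm_besselCoeff_mul_pow {a : ℝ} (ha : 0 < a) (x : ℝ) :
    Summable fun m ↦ ‖besselCoeff a m * x ^ m‖ := by
  rcases eq_or_ne x 0 with rfl | hx
  · refine summable_of_ne_finset_zero (s := {0}) fun m hm ↦ ?_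
    have : m ≠ 0 := by simpa using hm
    simp [this]
  have hr : ∀ m : ℕ, besselCoeff a (m + 1) * x ^ (m + 1) =
      besselCoeff a m * x ^ m * (-x / ((m + 1) * (a + m))) := by
    intro m
    have h1 := besselCoeff_succ a m
    have h2 := besselCoeff_eq_mul ha m
    have h3 : (m : ℝ) + 1 ≠ 0 := by positivity
    have h4 : a + (m : ℝ) ≠ 0 := by positivity
    rw [h2]
    field_simp
    rw [pow_succ]
    linear_combination x ^ m * x * h1
  refine summable_of_ratio_test_tendsto_lt_one (l := 0) one_pos ?_ ?_
  · exact Eventually.of_forall fun m ↦ by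
      have := besselCoeff_ne_zero ha m
      exact norm_ne_zero_iff.2 (mul_ne_zero this (pow_ne_zero _ hx))
  · have hlim : Tendsto (fun m : ℕ ↦ |x| * ((1 / ((m : ℝ) + 1)) * (1 / a))) atTop (𝓝 0) := by
      have := (tendsto_one_div_add_atTop_nhds_zero_nat (𝕜 := ℝ)).mul_const (1 / a)
      simpa using this.const_mul |x|
    refine squeeze_zero (fun m ↦ by positivity) (fun m ↦ ?_) hlim
    have h0 : ‖besselCoeff a m * x ^ m‖ ≠ 0 := by
      have := besselCoeff_ne_zero ha m
      exact norm_ne_zero_iff.2 (mul_ne_zero this (pow_ne_zero _ hx))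
    rw [norm_norm, norm_norm, hr, norm_mul, mul_div_cancel_left₀ _ h0, norm_div, norm_neg,
      Real.norm_eq_abs, Real.norm_eq_abs, abs_of_pos (show 0 < ((m : ℝ) + 1) * (a + m) by positivity),
      div_eq_mul_inv, mul_inv, one_div, one_div]
    gcongr
    linarith [(Nat.cast_nonneg m : (0 : ℝ) ≤ m)]

lemma summable_besselCoeff_mul_pow {a : ℝ} (ha : 0 < a) (x : ℝ) :
    Summable fun m ↦ besselCoeff a m * x ^ m :=
  (summable_norm_besselCoeff_mul_pow ha x).of_norm

lemma hasDerivAt_besselEntire {a : ℝ} (ha : 0 < a) (x : ℝ) :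
    HasDerivAt (besselEntire a) (-besselEntire (a + 1) x) x := by
  have hterm : ∀ (m : ℕ) (y : ℝ), besselCoeff a (m + 1) * (((m + 1 : ℕ) : ℝ) * y ^ (m + 1 - 1)) =
      -(besselCoeff (a + 1) m * y ^ m) := fun m y ↦ by
    have := besselCoeff_succ a m
    push_cast
    linear_combination y ^ m * this
  have ha1 : 0 < a + 1 := by linarith
  have hu : Summable fun m : ℕ ↦ |besselCoeff a m| * (m * (|x| + 1) ^ (m - 1)) := by
    rw [← summable_nat_add_iff 1]
    refine (summable_norm_besselCoeff_mul_pow ha1 (|x| + 1)).congr fun m ↦ ?_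
    rw [← norm_neg, ← hterm]
    simp only [norm_mul, norm_pow, Real.norm_eq_abs, Nat.abs_cast]
    rw [abs_of_pos (show 0 < |x| + 1 by positivity)]
  have hmem : x ∈ Metric.ball (0 : ℝ) (|x| + 1) := by simp
  have key := hasDerivAt_tsum_of_isPreconnected (𝕜 := ℝ)
    (g := fun m y ↦ besselCoeff a m * y ^ m)
    (g' := fun m y ↦ besselCoeff a m * (m * y ^ (m - 1))) hu Metric.isOpen_ball
    (convex_ball (0 : ℝ) (|x| + 1)).isPreconnected
    (fun m y _ ↦ (hasDerivAt_pow m y).const_mul _)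
    (fun m y hy ↦ by
      have hy' : |y| ≤ |x| + 1 := by simpa using (mem_ball_zero_iff.1 hy).le
      simp only [norm_mul, norm_pow, Real.norm_eq_abs, Nat.abs_cast]
      gcongr) hmem (summable_besselCoeff_mul_pow ha x) hmem
  have hs : Summable fun m : ℕ ↦ besselCoeff a m * (m * x ^ (m - 1)) := by
    rw [← summable_nat_add_iff 1]
    exact (summable_besselCoeff_mul_pow ha1 x).neg.congr fun m ↦ (hterm m x).symm
  have hval : ∑' m : ℕ, besselCoeff a m * (m * x ^ (m - 1)) = -besselEntire (a + 1) x := by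
    rw [hs.tsum_eq_zero_add, besselEntire, ← tsum_neg]
    simp only [hterm]
    simp
  rw [← hval]
  exact key

/-- The functional equation of Γ puts a factor a + m into the coefficients, and the part with the
factor m reindexes to the series for a + 2. Since each derivative raises `a` by one, this three-term
recurrence is the Bessel equation in disguise. -/
lemma besselEntire_eq {a : ℝ} (ha : 0 < a) (x : ℝ) :
    besselEntire a x = a * besselEntire (a + 1) x - x * besselEntire (a + 2) x := by
  have ha1 : 0 < a + 1 := by linarith
  have hs1 := summable_besselCoeff_mul_pow ha1 x
  have hs2 := summable_besselCoeff_mul_pow (show 0 < a + 2 by linarith) x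
  have hterm : ∀ m : ℕ, ((m + 1 : ℕ) : ℝ) * (besselCoeff (a + 1) (m + 1) * x ^ (m + 1)) =
      -x * (besselCoeff (a + 2) m * x ^ m) := fun m ↦ by
    have := besselCoeff_succ (a + 1) m
    rw [show a + 1 + 1 = a + 2 by ring] at this
    push_cast
    rw [pow_succ]
    linear_combination x ^ m * x * this
  have hs3 : Summable fun m : ℕ ↦ (m : ℝ) * (besselCoeff (a + 1) m * x ^ m) := by
    rw [← summable_nat_add_iff 1]
    exact (hs2.mul_left (-x)).congr fun m ↦ (hterm m).symm
  have h3 : ∑' m : ℕ, (m : ℝ) * (besselCoeff (a + 1) m * x ^ m) =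
      -x * besselEntire (a + 2) x := by
    rw [hs3.tsum_eq_zero_add, besselEntire, ← tsum_mul_left]
    simp only [hterm]
    simp
  have : besselEntire a x = ∑' m : ℕ, (a * (besselCoeff (a + 1) m * x ^ m) +
      m * (besselCoeff (a + 1) m * x ^ m)) := by
    unfold besselEntire
    congr 1 with m
    rw [besselCoeff_eq_mul ha]
    ring
  rw [this, (hs1.mul_left a).tsum_add hs3, h3, tsum_mul_left]
  unfold besselEntire
  ring

lemma besselEntire_zero {a : ℝ} (ha : 0 < a) : 0 < besselEntire a 0 := by
  unfold besselEntire
  rw [tsum_eq_single 0 fun m hm ↦ by simp [hm]]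
  have := Real.Gamma_pos_of_pos ha
  simp [besselCoeff, this]

lemma continuous_besselEntire {a : ℝ} (ha : 0 < a) : Continuous (besselEntire a) :=
  continuous_iff_continuousAt.2 fun x ↦ (hasDerivAt_besselEntire ha x).continuousAt

lemma besselJ_eq {a t : ℝ} (ht : 0 < t) :
    besselJ (a - 1) t = (t / 2) ^ (a - 1) * besselEntire a (t ^ 2 / 4) := by
  unfold besselJ besselEntire
  rw [← tsum_mul_left]
  congr 1 with m
  have h2 : 0 < t / 2 := by positivity
  rw [Real.rpow_add h2, show (2 : ℝ) * m = ((2 * m : ℕ) : ℝ) by push_cast; ring,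
    Real.rpow_natCast, pow_mul, show (t / 2) ^ 2 = t ^ 2 / 4 by ring, besselCoeff,
    show (m : ℝ) + (a - 1) + 1 = m + a by ring]
  ring

/-! ### The radial Bessel equation. -/

/-- The radial solution `s ↦ besselEntire (ν / 2) (τ ^ 2 s ^ 2 / 4)` of
`(s ^ (ν - 1) f')' = - τ ^ 2 s ^ (ν - 1) f`. -/
noncomputable def besselRadial (ν τ s : ℝ) : ℝ :=
  besselEntire (ν / 2) (τ ^ 2 * s ^ 2 / 4)

/-- The function `s ↦ - f'(s) / s` for `f = besselRadial ν τ`. -/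
noncomputable def besselRadialSlope (ν τ s : ℝ) : ℝ :=
  τ ^ 2 / 2 * besselEntire (ν / 2 + 1) (τ ^ 2 * s ^ 2 / 4)

lemma hasDerivAt_radialArg (τ s : ℝ) :
    HasDerivAt (fun s : ℝ ↦ τ ^ 2 * s ^ 2 / 4) (τ ^ 2 * s / 2) s := by
  have := (((hasDerivAt_id s).pow 2).const_mul (τ ^ 2)).div_const 4
  exact this.congr_deriv (by simp; ring)

lemma hasDerivAt_besselRadial {ν : ℝ} (hν : 0 < ν) (τ s : ℝ) :
    HasDerivAt (besselRadial ν τ) (-(s * besselRadialSlope ν τ s)) s := by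
  have := (hasDerivAt_besselEntire (half_pos hν) (τ ^ 2 * s ^ 2 / 4)).comp s
    (hasDerivAt_radialArg τ s)
  exact this.congr_deriv (by unfold besselRadialSlope; ring)

lemma continuous_besselRadial {ν : ℝ} (hν : 0 < ν) (τ : ℝ) : Continuous (besselRadial ν τ) :=
  (continuous_besselEntire (half_pos hν)).comp (by fun_prop)

lemma hasDerivAt_besselRadialSlope {ν : ℝ} (hν : 0 < ν) (τ s : ℝ) :
    HasDerivAt (besselRadialSlope ν τ)
      (-(τ ^ 4 / 4 * s * besselEntire (ν / 2 + 2) (τ ^ 2 * s ^ 2 / 4))) s := by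
  have := ((hasDerivAt_besselEntire (show 0 < ν / 2 + 1 by positivity) (τ ^ 2 * s ^ 2 / 4)).comp s
    (hasDerivAt_radialArg τ s)).const_mul (τ ^ 2 / 2)
  refine this.congr_deriv ?_
  rw [show ν / 2 + 1 + 1 = ν / 2 + 2 by ring]
  ring

lemma continuous_besselRadialSlope {ν : ℝ} (hν : 0 < ν) (τ : ℝ) :
    Continuous (besselRadialSlope ν τ) :=
  continuous_iff_continuousAt.2 fun s ↦ (hasDerivAt_besselRadialSlope hν τ s).continuousAt

lemma deriv_besselRadial {ν : ℝ} (hν : 0 < ν) (τ s : ℝ) :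
    deriv (besselRadial ν τ) s = -(s * besselRadialSlope ν τ s) :=
  (hasDerivAt_besselRadial hν τ s).deriv

lemma contDiff_besselRadial {ν : ℝ} (hν : 0 < ν) (τ : ℝ) : ContDiff ℝ 1 (besselRadial ν τ) := by
  rw [contDiff_one_iff_deriv]
  refine ⟨fun s ↦ (hasDerivAt_besselRadial hν τ s).differentiableAt, ?_⟩
  rw [funext (deriv_besselRadial hν τ)]
  exact (continuous_id.mul (continuous_besselRadialSlope hν τ)).neg

/-- The equation `(s ^ (ν - 1) f')' = - τ ^ 2 s ^ (ν - 1) f`, with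
`s ^ (ν - 1) f' = - s ^ ν * besselRadialSlope`. -/
lemma hasDerivAt_rpow_mul_besselRadialSlope {ν : ℝ} (hν : 0 < ν) (τ : ℝ) {s : ℝ} (hs : 0 < s) :
    HasDerivAt (fun s ↦ s ^ ν * besselRadialSlope ν τ s)
      (τ ^ 2 * (s ^ (ν - 1) * besselRadial ν τ s)) s := by
  have := (Real.hasDerivAt_rpow_const (p := ν) (Or.inl hs.ne')).mul
    (hasDerivAt_besselRadialSlope hν τ s)
  refine this.congr_deriv ?_
  unfold besselRadial besselRadialSlope
  -- The differential equation is exactly the recurrence at a = ν/2.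
  rw [besselEntire_eq (half_pos hν)]
  have : s ^ ν = s ^ (ν - 1) * s := by
    rw [← Real.rpow_add_one hs.ne', sub_add_cancel]
  rw [this]
  ring

/-! ### Lower bound for the radial eigenvalue by Picone's inequality. -/

lemma ofReal_integral_le_lintegral_ofReal {α : Type*} [MeasurableSpace α] {μ : Measure α}
    {g : α → ℝ} (hg : Integrable g μ) :
    ENNReal.ofReal (∫ x, g x ∂μ) ≤ ∫⁻ x, ENNReal.ofReal (g x) ∂μ := by
  calc ENNReal.ofReal (∫ x, g x ∂μ) ≤ ENNReal.ofReal (∫ x, max (g x) 0 ∂μ) :=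
        ENNReal.ofReal_le_ofReal (integral_mono hg hg.pos_part fun x ↦ le_max_left _ _)
    _ = ∫⁻ x, ENNReal.ofReal (max (g x) 0) ∂μ :=
        ofReal_integral_eq_lintegral_ofReal hg.pos_part
          (Eventually.of_forall fun x ↦ le_max_right _ _)
    _ = ∫⁻ x, ENNReal.ofReal (g x) ∂μ := by simp [ENNReal.ofReal_max]

lemma contDiff_besselEntire {a : ℝ} (ha : 0 < a) : ContDiff ℝ 1 (besselEntire a) := by
  rw [contDiff_one_iff_deriv]
  refine ⟨fun s ↦ (hasDerivAt_besselEntire ha s).differentiableAt, ?_⟩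
  rw [funext fun x ↦ (hasDerivAt_besselEntire ha x).deriv]
  exact (continuous_besselEntire (by linarith)).neg

lemma contDiff_besselRadialSlope {ν : ℝ} (hν : 0 < ν) (τ : ℝ) :
    ContDiff ℝ 1 (besselRadialSlope ν τ) :=
  contDiff_const.mul ((contDiff_besselEntire (by positivity)).comp (by fun_prop))

/-- The flux s^ν k vanishes at 0 and has derivative τ² s^(ν-1) f ≥ 0, so a nonnegative radial
solution is nonincreasing. -/
lemma besselRadialSlope_nonneg {ν τ : ℝ} (hν : 0 < ν)
    (hpos : ∀ s ∈ Set.Ioo (0 : ℝ) 1, 0 ≤ besselRadial ν τ s) {s : ℝ} (hs0 : 0 < s) (hs1 : s ≤ 1) :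
    0 ≤ besselRadialSlope ν τ s := by
  have hcont : Continuous fun s : ℝ ↦ s ^ ν * besselRadialSlope ν τ s :=
    (Real.continuous_rpow_const hν.le).mul (continuous_besselRadialSlope hν τ)
  have hmono : MonotoneOn (fun s : ℝ ↦ s ^ ν * besselRadialSlope ν τ s) (Set.Icc 0 1) := by
    refine monotoneOn_of_deriv_nonneg (convex_Icc 0 1) hcont.continuousOn ?_ ?_
    · rw [interior_Icc]
      exact fun x hx ↦ (hasDerivAt_rpow_mul_besselRadialSlope hν τ hx.1).differentiableAt
        |>.differentiableWithinAt
    · rw [interior_Icc]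
      intro x hx
      rw [(hasDerivAt_rpow_mul_besselRadialSlope hν τ hx.1).deriv]
      have h1 := hpos x hx
      have h2 := Real.rpow_nonneg hx.1.le (ν - 1)
      positivity
  have h := hmono (Set.left_mem_Icc.2 zero_le_one) ⟨hs0.le, hs1⟩ hs0.le
  simp only [Real.zero_rpow hν.ne', zero_mul] at h
  exact nonneg_of_mul_nonneg_right h (Real.rpow_pos_of_pos hs0 ν)

/-- Picone's inequality for the weight `s ^ (ν - 1)` on `[ε, 1]`. -/
lemma setLIntegral_le_of_besselRadial_pos {ν τ ε : ℝ} (hν : 0 < ν) (hε0 : 0 < ε) (hε1 : ε < 1)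
    (hpos : ∀ s ∈ Set.Icc (0 : ℝ) 1, 0 < besselRadial ν τ s)
    {ψ : ℝ → ℝ} {K : NNReal} (hψ : LipschitzOnWith K ψ (Set.Icc 0 1)) (hψ1 : ψ 1 = 0) :
    ENNReal.ofReal (τ ^ 2) * ∫⁻ s in Set.Ioo ε 1, ENNReal.ofReal (ψ s ^ 2 * s ^ (ν - 1)) ≤
      ∫⁻ s in Set.Ioo ε 1, ENNReal.ofReal (deriv ψ s ^ 2 * s ^ (ν - 1)) := by
  set f := besselRadial ν τ
  set k := besselRadialSlope ν τ
  have hsub : Set.Icc ε 1 ⊆ Set.Icc (0 : ℝ) 1 := Set.Icc_subset_Icc_left hε0.le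
  have hu : Set.uIcc ε 1 = Set.Icc ε 1 := Set.uIcc_of_le hε1.le
  -- Picone's multiplier h = s^(ν-1) f'/f. The weight may be singular at 0, so absolute continuity
  -- of ψ² h is used only on [ε, 1].
  set h : ℝ → ℝ := fun s ↦ -(s ^ ν * k s / f s) with hdef
  have hψac : AbsolutelyContinuousOnInterval ψ ε 1 :=
    (hψ.mono (hu ▸ hsub)).absolutelyContinuousOnInterval
  have hhac : AbsolutelyContinuousOnInterval h ε 1 := by
    refine ContDiffOn.absolutelyContinuousOnInterval ?_
    rw [hu]
    refine ContDiffOn.neg (ContDiffOn.div (ContDiffOn.mul ?_ ?_) ?_ ?_)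
    · exact contDiffOn_id.rpow_const_of_ne fun s hs ↦ (hε0.trans_le hs.1).ne'
    · exact (contDiff_besselRadialSlope hν τ).contDiffOn
    · exact (contDiff_besselRadial hν τ).contDiffOn
    · exact fun s hs ↦ (hpos s (hsub hs)).ne'
  have hH := (hψac.mul hψac).mul hhac
  set H : ℝ → ℝ := ψ * ψ * h with hHdef
  have hder : ∀ s ∈ Set.Ioo ε 1, HasDerivAt h
      (-(s ^ (ν - 1) * (τ ^ 2 + (s * k s / f s) ^ 2))) s := fun s hs ↦ by
    have hs0 : 0 < s := hε0.trans hs.1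
    have hf := (hpos s (hsub (Set.Ioo_subset_Icc_self hs))).ne'
    have := ((hasDerivAt_rpow_mul_besselRadialSlope hν τ hs0).div
      (hasDerivAt_besselRadial hν τ s) hf).neg
    refine this.congr_deriv ?_
    change -((τ ^ 2 * (s ^ (ν - 1) * f s) * f s - s ^ ν * k s * -(s * k s)) / f s ^ 2) = _
    have hsν : s ^ ν = s ^ (ν - 1) * s := by rw [← Real.rpow_add_one hs0.ne', sub_add_cancel]
    rw [hsν]
    field_simp
    ring
  have hHint : ∫ s in ε..1, deriv H s = ψ ε ^ 2 * (ε ^ ν * k ε / f ε) := by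
    rw [hH.integral_deriv_eq_sub]
    simp only [hHdef, hdef, Pi.mul_apply, hψ1]
    ring
  -- The boundary term at 1 vanishes with ψ; the one at ε has the favourable sign because f is
  -- nonincreasing.
  have hHnonneg : 0 ≤ ∫ s in ε..1, deriv H s := by
    rw [hHint]
    have h1 := besselRadialSlope_nonneg hν
      (fun s hs ↦ (hpos s (Set.Ioo_subset_Icc_self hs)).le) hε0 hε1.le
    have h2 := hpos ε ⟨hε0.le, hε1.le⟩
    have h3 := Real.rpow_nonneg hε0.le ν
    positivity
  have hwint : IntervalIntegrable (fun s ↦ τ ^ 2 * (ψ s ^ 2 * s ^ (ν - 1))) volume ε 1 := by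
    refine ContinuousOn.intervalIntegrable ?_
    refine continuousOn_const.mul ((hψac.continuousOn.pow 2).mul ?_)
    rw [hu]
    exact continuousOn_id.rpow_const fun s hs ↦ Or.inl (hε0.trans_le hs.1).ne'
  have hHdint := hH.intervalIntegrable_deriv
  have hle : ∀ᵐ s, s ∈ Set.Ioo ε 1 →
      τ ^ 2 * (ψ s ^ 2 * s ^ (ν - 1)) + deriv H s ≤ deriv ψ s ^ 2 * s ^ (ν - 1) := by
    filter_upwards [hψac.ae_differentiableAt] with s hs hs'
    have hs0 : 0 < s := hε0.trans hs'.1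
    have hd := (hs (hu ▸ Set.Ioo_subset_Icc_self hs')).hasDerivAt
    have hHd := ((hd.mul hd).mul (hder s hs')).deriv
    have hsν : s ^ ν = s ^ (ν - 1) * s := by rw [← Real.rpow_add_one hs0.ne', sub_add_cancel]
    rw [hHd]
    simp only [hdef, Pi.mul_apply, hsν]
    have hw := Real.rpow_nonneg hs0.le (ν - 1)
    -- The defect in the pointwise inequality is the square s^(ν-1) (ψ' - ψ f'/f)².
    have := mul_nonneg hw (sq_nonneg (deriv ψ s + ψ s * (s * k s / f s)))
    rw [mul_div_assoc, mul_assoc, ← mul_div_assoc s]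
    linarith
  calc ENNReal.ofReal (τ ^ 2) * ∫⁻ s in Set.Ioo ε 1, ENNReal.ofReal (ψ s ^ 2 * s ^ (ν - 1))
      = ∫⁻ s in Set.Ioo ε 1, ENNReal.ofReal (τ ^ 2 * (ψ s ^ 2 * s ^ (ν - 1))) := by
        rw [← lintegral_const_mul' _ _ ENNReal.ofReal_ne_top]
        simp_rw [ENNReal.ofReal_mul (sq_nonneg τ)]
    _ = ENNReal.ofReal (∫ s in ε..1, τ ^ 2 * (ψ s ^ 2 * s ^ (ν - 1))) := by
        rw [intervalIntegral.integral_of_le hε1.le, integral_Ioc_eq_integral_Ioo,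
          ofReal_integral_eq_lintegral_ofReal]
        · exact ((intervalIntegrable_iff_integrableOn_Ioo_of_le hε1.le).1 hwint)
        · refine (ae_restrict_iff' measurableSet_Ioo).2 (Eventually.of_forall fun s hs ↦ ?_)
          have := Real.rpow_nonneg (hε0.trans hs.1).le (ν - 1)
          positivity
    _ ≤ ENNReal.ofReal (∫ s in ε..1, (τ ^ 2 * (ψ s ^ 2 * s ^ (ν - 1)) + deriv H s)) := by
        rw [intervalIntegral.integral_add hwint hHdint]
        exact ENNReal.ofReal_le_ofReal (by linarith)
    _ ≤ ∫⁻ s in Set.Ioo ε 1, ENNReal.ofReal (τ ^ 2 * (ψ s ^ 2 * s ^ (ν - 1)) + deriv H s) := by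
        rw [intervalIntegral.integral_of_le hε1.le, integral_Ioc_eq_integral_Ioo]
        exact ofReal_integral_le_lintegral_ofReal
          ((intervalIntegrable_iff_integrableOn_Ioo_of_le hε1.le).1 (hwint.add hHdint))
    _ ≤ _ := lintegral_mono_ae ((ae_restrict_iff' measurableSet_Ioo).2
        (hle.mono fun s hs hs' ↦ ENNReal.ofReal_le_ofReal (hs hs')))

lemma intervalIntegrable_sq_mul_rpow {ν : ℝ} (hν : 0 < ν) {ψ : ℝ → ℝ}
    (hψ : ContinuousOn ψ (Set.Icc 0 1)) :
    IntervalIntegrable (fun s ↦ ψ s ^ 2 * s ^ (ν - 1)) volume 0 1 :=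
  (intervalIntegral.intervalIntegrable_rpow' (by linarith)).continuousOn_mul
    (by rw [Set.uIcc_of_le zero_le_one]; exact hψ.pow 2)

lemma setLIntegral_sq_mul_rpow {ν : ℝ} (hν : 0 < ν) {ψ : ℝ → ℝ}
    (hψ : ContinuousOn ψ (Set.Icc 0 1)) :
    ∫⁻ s in Set.Ioo (0 : ℝ) 1, ENNReal.ofReal (ψ s ^ 2 * s ^ (ν - 1)) =
      ENNReal.ofReal (∫ s in (0 : ℝ)..1, ψ s ^ 2 * s ^ (ν - 1)) := by
  rw [intervalIntegral.integral_of_le zero_le_one, integral_Ioc_eq_integral_Ioo,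
    ofReal_integral_eq_lintegral_ofReal]
  · exact (intervalIntegrable_iff_integrableOn_Ioo_of_le zero_le_one).1
      (intervalIntegrable_sq_mul_rpow hν hψ)
  · refine (ae_restrict_iff' measurableSet_Ioo).2 (Eventually.of_forall fun s hs ↦ ?_)
    exact mul_nonneg (sq_nonneg _) (Real.rpow_nonneg hs.1.le (ν - 1))

lemma setLIntegral_sq_mul_rpow_ne_zero (ν : ℝ) {ψ : ℝ → ℝ}
    (hψ : ContinuousOn ψ (Set.Icc 0 1)) (hne : ∃ s ∈ Set.Icc (0 : ℝ) 1, ψ s ≠ 0) :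
    ∫⁻ s in Set.Ioo (0 : ℝ) 1, ENNReal.ofReal (ψ s ^ 2 * s ^ (ν - 1)) ≠ 0 := by
  intro h0
  obtain ⟨s, hs, hsne⟩ := hne
  have hcont : ContinuousOn (fun s : ℝ ↦ ENNReal.ofReal (ψ s ^ 2 * s ^ (ν - 1)))
      (Set.Ioo 0 1) := by
    refine ENNReal.continuous_ofReal.comp_continuousOn
      (((hψ.mono Set.Ioo_subset_Icc_self).pow 2).mul ?_)
    exact continuousOn_id.rpow_const fun s hs ↦ Or.inl hs.1.ne'
  rw [lintegral_eq_zero_iff' (hcont.aemeasurable measurableSet_Ioo)] at h0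
  have h1 : ψ =ᵐ[volume.restrict (Set.Icc (0 : ℝ) 1)] fun _ ↦ 0 := by
    rw [← restrict_Ioo_eq_restrict_Icc]
    filter_upwards [h0, ae_restrict_mem measurableSet_Ioo] with x hx hx'
    have hw := Real.rpow_pos_of_pos hx'.1 (ν - 1)
    simp only [Pi.zero_apply, ENNReal.ofReal_eq_zero] at hx
    have : ψ x ^ 2 ≤ 0 := by
      by_contra! hc
      exact absurd hx (not_le.2 (mul_pos hc hw))
    exact pow_eq_zero_iff two_ne_zero |>.1 (le_antisymm this (sq_nonneg _))
  exact hsne (Measure.eqOn_Icc_of_ae_eq volume zero_ne_one h1 hψ continuousOn_const hs)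

lemma le_radialEigenvalue_of_besselRadial_pos {ν τ : ℝ} (hν : 0 < ν)
    (hpos : ∀ s ∈ Set.Icc (0 : ℝ) 1, 0 < besselRadial ν τ s) :
    ENNReal.ofReal (τ ^ 2) ≤ radialEigenvalue ν := by
  refine le_iInf₂ fun ψ ⟨⟨K, hK⟩, hψ1, hne⟩ ↦ ?_
  have hden : ∫⁻ s in Set.Ioo (0 : ℝ) 1, ENNReal.ofReal (ψ s ^ 2 * s ^ (ν - 1)) ≠ ⊤ := by
    rw [setLIntegral_sq_mul_rpow hν hK.continuousOn]
    exact ENNReal.ofReal_ne_top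
  rw [ENNReal.le_div_iff_mul_le
    (Or.inl (setLIntegral_sq_mul_rpow_ne_zero ν hK.continuousOn hne)) (Or.inl hden)]
  -- Exhaustion of (0, 1) for monotone convergence; the shift by 2 keeps the left end below 1
  -- already for n = 0.
  have hU : Set.Ioo (0 : ℝ) 1 = ⋃ n : ℕ, Set.Ioo (1 / ((n : ℝ) + 2)) 1 := by
    ext s
    simp only [Set.mem_Ioo, Set.mem_iUnion, exists_and_right, and_congr_left_iff]
    refine fun _ ↦ ⟨fun hs ↦ ?_, fun ⟨n, hn⟩ ↦ lt_trans (by positivity) hn⟩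
    obtain ⟨n, hn⟩ := exists_nat_one_div_lt hs
    exact ⟨n, lt_of_le_of_lt (by gcongr; linarith) hn⟩
  have hdir : Directed (· ⊆ ·) fun n : ℕ ↦ Set.Ioo (1 / ((n : ℝ) + 2)) 1 :=
    directed_of_isDirected_le fun m n hmn ↦ Set.Ioo_subset_Ioo_left (by gcongr)
  rw [hU, setLIntegral_iUnion_of_directed _ hdir, ENNReal.mul_iSup, ← hU]
  refine iSup_le fun n ↦ ?_
  have hn0 : (0 : ℝ) < 1 / ((n : ℝ) + 2) := by positivity
  have hn1 : 1 / ((n : ℝ) + 2) < 1 := by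
    rw [div_lt_one (by positivity)]
    linarith [(Nat.cast_nonneg n : (0 : ℝ) ≤ n)]
  exact (setLIntegral_le_of_besselRadial_pos hν hn0 hn1 hpos hK hψ1).trans
    (lintegral_mono_set (Set.Ioo_subset_Ioo_left hn0.le))

/-! ### Upper bounds for the radial eigenvalue by test functions. -/

/-- The Rayleigh quotient of a `C¹` function, through a primitive of
`s ^ (ν - 1) (ψ' ^ 2 - c ψ ^ 2)`. -/
lemma integral_deriv_sq_mul_rpow_eq {ν c : ℝ} (hν : 0 < ν) {ψ ψ' G : ℝ → ℝ}
    (hψ : Continuous ψ) (hψ' : Continuous ψ') (hG : ContinuousOn G (Set.Icc 0 1))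
    (hG' : ∀ s ∈ Set.Ioo (0 : ℝ) 1,
      HasDerivAt G (ψ' s ^ 2 * s ^ (ν - 1) - c * (ψ s ^ 2 * s ^ (ν - 1))) s)
    (hG01 : G 0 = G 1) :
    ∫ s in (0 : ℝ)..1, ψ' s ^ 2 * s ^ (ν - 1) = c * ∫ s in (0 : ℝ)..1, ψ s ^ 2 * s ^ (ν - 1) := by
  have h1 := intervalIntegrable_sq_mul_rpow hν hψ'.continuousOn
  have h2 := (intervalIntegrable_sq_mul_rpow hν hψ.continuousOn).const_mul c
  have := intervalIntegral.integral_eq_sub_of_hasDerivAt_of_le zero_le_one hG hG' (h1.sub h2)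
  rw [intervalIntegral.integral_sub h1 h2, intervalIntegral.integral_const_mul, hG01, sub_self] at this
  linarith

lemma radialEigenvalue_le_of_primitive {ν c : ℝ} (hν : 0 < ν) (hc : 0 ≤ c) {ψ G : ℝ → ℝ}
    (hψ : ContDiff ℝ 1 ψ) (hψ1 : ψ 1 = 0) (hψ0 : ψ 0 ≠ 0) (hG : ContinuousOn G (Set.Icc 0 1))
    (hG' : ∀ s ∈ Set.Ioo (0 : ℝ) 1,
      HasDerivAt G (deriv ψ s ^ 2 * s ^ (ν - 1) - c * (ψ s ^ 2 * s ^ (ν - 1))) s)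
    (hG01 : G 0 = G 1) :
    radialEigenvalue ν ≤ ENNReal.ofReal c := by
  obtain ⟨K, hK⟩ := hψ.contDiffOn.exists_lipschitzOnWith (s := Set.Icc (0 : ℝ) 1) (by decide)
    (convex_Icc _ _) isCompact_Icc
  refine (iInf₂_le ψ ⟨⟨K, hK⟩, hψ1, 0, by simp, hψ0⟩).trans ?_
  have hψ' : Continuous (deriv ψ) := hψ.continuous_deriv le_rfl
  rw [setLIntegral_sq_mul_rpow hν hψ'.continuousOn,
    setLIntegral_sq_mul_rpow hν hψ.continuous.continuousOn,
    integral_deriv_sq_mul_rpow_eq hν hψ.continuous hψ' hG hG' hG01, ENNReal.ofReal_mul hc]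
  exact ENNReal.div_le_of_le_mul le_rfl

/-- The test function is 1 - s². Its energy is 4/(ν+2) and its mass 8/(ν(ν+2)(ν+4)); equivalently, c
is the value for which the primitive G vanishes at 1 as well as at 0. -/
lemma radialEigenvalue_le_quadratic {ν : ℝ} (hν : 0 < ν) :
    radialEigenvalue ν ≤ ENNReal.ofReal (ν * (ν + 4) / 2) := by
  set c := ν * (ν + 4) / 2 with hc
  have hd : ∀ s : ℝ, HasDerivAt (fun s : ℝ ↦ 1 - s ^ 2) (-(2 * s)) s := fun s ↦
    (((hasDerivAt_id s).pow 2).const_sub 1).congr_deriv (by simp)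
  refine radialEigenvalue_le_of_primitive (ψ := fun s ↦ 1 - s ^ 2)
    (G := fun s ↦ s ^ ν * (-(c / ν) + (4 + 2 * c) / (ν + 2) * s ^ 2 - c / (ν + 4) * s ^ 4))
    hν (by positivity) (by fun_prop) (by simp) (by simp) ?_ ?_ ?_
  · exact ((Real.continuous_rpow_const hν.le).mul (by fun_prop)).continuousOn
  · intro s hs
    rw [(hd s).deriv]
    have h2 : HasDerivAt (fun s : ℝ ↦ -(c / ν) + (4 + 2 * c) / (ν + 2) * s ^ 2 - c / (ν + 4) * s ^ 4)
        ((4 + 2 * c) / (ν + 2) * (2 * s) - c / (ν + 4) * (4 * s ^ 3)) s :=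
      (((((hasDerivAt_id s).pow 2).const_mul ((4 + 2 * c) / (ν + 2))).const_add _).sub
        (((hasDerivAt_id s).pow 4).const_mul (c / (ν + 4)))).congr_deriv (by simp)
    refine ((Real.hasDerivAt_rpow_const (p := ν) (Or.inl hs.1.ne')).mul h2).congr_deriv ?_
    have hsν : s ^ ν = s ^ (ν - 1) * s := by rw [← Real.rpow_add_one hs.1.ne', sub_add_cancel]
    rw [hsν]
    have h4 : ν + 2 ≠ 0 := by positivity
    have h5 : ν + 4 ≠ 0 := by positivity
    field_simp
    ring
  · have h4 : ν + 2 ≠ 0 := by positivity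
    have h5 : ν + 4 ≠ 0 := by positivity
    simp only [Real.zero_rpow hν.ne', Real.one_rpow, hc]
    field_simp
    ring

/-! ### The first Bessel zero and the value of the radial eigenvalue. -/

lemma besselRadial_zero_pos {ν : ℝ} (hν : 0 < ν) (τ : ℝ) : 0 < besselRadial ν τ 0 := by
  unfold besselRadial
  simpa using besselEntire_zero (half_pos hν)

lemma besselRadial_mul (ν τ s : ℝ) : besselRadial ν τ s = besselRadial ν 1 (τ * s) := by
  unfold besselRadial
  ring_nf

lemma besselJ_eq_zero_iff {ν t : ℝ} (ht : 0 < t) :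
    besselJ (ν / 2 - 1) t = 0 ↔ besselRadial ν 1 t = 0 := by
  rw [besselJ_eq ht, besselRadial, one_pow, one_mul, mul_eq_zero, or_iff_right]
  exact (Real.rpow_pos_of_pos (half_pos ht) _).ne'

lemma besselRadial_pos_of_forall_ne {ν T : ℝ} (hν : 0 < ν)
    (h : ∀ t, 0 < t → t ≤ T → besselRadial ν 1 t ≠ 0) {t : ℝ} (ht0 : 0 ≤ t) (ht : t ≤ T) :
    0 < besselRadial ν 1 t := by
  by_contra! hc
  obtain ⟨u, hu, hu0⟩ := intermediate_value_Icc' ht0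
    (continuous_besselRadial hν 1).continuousOn ⟨hc, (besselRadial_zero_pos hν 1).le⟩
  have hu_pos : 0 < u := by
    rcases hu.1.eq_or_lt with h0 | h0
    · exact absurd hu0 (h0 ▸ (besselRadial_zero_pos hν 1).ne')
    · exact h0
  exact h u hu_pos (hu.2.trans ht) hu0

/-- Without a zero, Picone's inequality would give τ² ≤ λ_ν for every τ, against the quadratic upper
bound; τ = ν + 4 is large enough. -/
lemma exists_besselRadial_eq_zero {ν : ℝ} (hν : 0 < ν) :
    ∃ t, 0 < t ∧ besselRadial ν 1 t = 0 := by
  by_contra! hc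
  set τ := ν + 4
  have h := (le_radialEigenvalue_of_besselRadial_pos (τ := τ) hν fun s hs ↦ by
    rw [besselRadial_mul]
    exact besselRadial_pos_of_forall_ne hν (fun t ht _ ↦ hc t ht)
      (mul_nonneg (by positivity) hs.1) le_rfl).trans (radialEigenvalue_le_quadratic hν)
  rw [ENNReal.ofReal_le_ofReal_iff (by positivity)] at h
  nlinarith

/-- Adjoining t = 0 to the domain makes the zero set closed and adds no zero, since the radial
solution is positive there. Hence the infimum is attained. -/
lemma isLeast_besselFirstZero {ν : ℝ} (hν : 0 < ν) :
    IsLeast {t : ℝ | 0 < t ∧ besselJ (ν / 2 - 1) t = 0} (besselFirstZero (ν / 2 - 1)) := by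
  have hS : {t : ℝ | 0 < t ∧ besselJ (ν / 2 - 1) t = 0} =
      Set.Ici 0 ∩ besselRadial ν 1 ⁻¹' {0} := by
    ext t
    simp only [Set.mem_ofPred_eq, Set.mem_inter_iff, Set.mem_Ici, Set.mem_preimage,
      Set.mem_singleton_iff]
    refine ⟨fun ⟨h1, h2⟩ ↦ ⟨h1.le, (besselJ_eq_zero_iff h1).1 h2⟩, fun ⟨h1, h2⟩ ↦ ?_⟩
    rcases h1.eq_or_lt with h0 | h0
    · exact absurd h2 (h0 ▸ (besselRadial_zero_pos hν 1).ne')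
    · exact ⟨h0, (besselJ_eq_zero_iff h0).2 h2⟩
  unfold besselFirstZero
  rw [hS]
  refine IsClosed.isLeast_csInf ?_ ?_ ⟨0, fun t ht ↦ ht.1⟩
  · exact isClosed_Ici.inter (isClosed_singleton.preimage (continuous_besselRadial hν 1))
  · obtain ⟨t, ht, h0⟩ := exists_besselRadial_eq_zero hν
    exact ⟨t, ht.le, h0⟩

lemma besselFirstZero_pos {ν : ℝ} (hν : 0 < ν) : 0 < besselFirstZero (ν / 2 - 1) :=
  (isLeast_besselFirstZero hν).1.1

lemma besselRadial_besselFirstZero {ν : ℝ} (hν : 0 < ν) :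
    besselRadial ν (besselFirstZero (ν / 2 - 1)) 1 = 0 := by
  rw [besselRadial_mul, mul_one]
  exact (besselJ_eq_zero_iff (besselFirstZero_pos hν)).1 (isLeast_besselFirstZero hν).1.2

lemma besselRadial_one_pos {ν t : ℝ} (hν : 0 < ν) (ht0 : 0 ≤ t)
    (ht : t < besselFirstZero (ν / 2 - 1)) : 0 < besselRadial ν 1 t :=
  besselRadial_pos_of_forall_ne hν (fun _ hu hut h0 ↦ absurd
    ((isLeast_besselFirstZero hν).2 ⟨hu, (besselJ_eq_zero_iff hu).2 h0⟩)
    (not_le.2 (hut.trans_lt ht))) ht0 le_rfl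

/-- The primitive of `s ^ (ν - 1) (f' ^ 2 - τ ^ 2 f ^ 2)` for `f = besselRadial ν τ`. -/
lemma hasDerivAt_besselRadial_primitive {ν : ℝ} (hν : 0 < ν) (τ : ℝ) {s : ℝ} (hs : 0 < s) :
    HasDerivAt (fun s ↦ -(s ^ ν * besselRadialSlope ν τ s * besselRadial ν τ s))
      (deriv (besselRadial ν τ) s ^ 2 * s ^ (ν - 1) -
        τ ^ 2 * (besselRadial ν τ s ^ 2 * s ^ (ν - 1))) s := by
  refine ((hasDerivAt_rpow_mul_besselRadialSlope hν τ hs).mul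
    (hasDerivAt_besselRadial hν τ s)).neg.congr_deriv ?_
  have hsν : s ^ ν = s ^ (ν - 1) * s := by rw [← Real.rpow_add_one hs.ne', sub_add_cancel]
  rw [deriv_besselRadial hν, hsν]
  ring

lemma continuous_besselRadial_primitive {ν : ℝ} (hν : 0 < ν) (τ : ℝ) :
    Continuous fun s : ℝ ↦ -(s ^ ν * besselRadialSlope ν τ s * besselRadial ν τ s) :=
  (((Real.continuous_rpow_const hν.le).mul (continuous_besselRadialSlope hν τ)).mul
    (continuous_besselRadial hν τ)).neg

/-- The radial solution with τ = j is a test function with quotient j². For τ < j the solution is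
positive on all of [0, 1], so Picone applies, and τ tends to j from below. -/
lemma radialEigenvalue_eq {ν : ℝ} (hν : 0 < ν) :
    radialEigenvalue ν = ENNReal.ofReal (besselFirstZero (ν / 2 - 1) ^ 2) := by
  set j := besselFirstZero (ν / 2 - 1)
  have hj : 0 < j := besselFirstZero_pos hν
  have hj1 : besselRadial ν j 1 = 0 := besselRadial_besselFirstZero hν
  apply le_antisymm
  · refine radialEigenvalue_le_of_primitive hν (sq_nonneg j) (contDiff_besselRadial hν j) hj1
      (besselRadial_zero_pos hν j).ne' (continuous_besselRadial_primitive hν j).continuousOn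
      (fun s hs ↦ hasDerivAt_besselRadial_primitive hν j hs.1) ?_
    simp [hj1, Real.zero_rpow hν.ne']
  · have hlim : Tendsto (fun τ : ℝ ↦ ENNReal.ofReal (τ ^ 2)) (𝓝[<] j)
        (𝓝 (ENNReal.ofReal (j ^ 2))) :=
      ((ENNReal.continuous_ofReal.comp (continuous_pow 2)).tendsto j).mono_left nhdsWithin_le_nhds
    refine le_of_tendsto hlim ?_
    filter_upwards [Ioo_mem_nhdsLT hj] with τ hτ
    refine le_radialEigenvalue_of_besselRadial_pos hν fun s hs ↦ ?_
    rw [besselRadial_mul]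
    refine besselRadial_one_pos hν (mul_nonneg hτ.1.le hs.1) (lt_of_le_of_lt ?_ hτ.2)
    exact mul_le_of_le_one_right hτ.1.le hs.2

/-! ### Global Lipschitz bounds for the test functions. -/

/-- Near a point of the support there are two cases: points closer than δ obey the local Lipschitz
bound, points at distance at least δ obey 2B/δ, where B bounds |f|. Compactness of the support makes
the constant uniform. -/
lemma LocallyLipschitz.exists_lipschitzWith_of_hasCompactSupport {X : Type*} [EMetricSpace X]
    {f : X → ℝ} (hf : LocallyLipschitz f) (hc : HasCompactSupport f) :
    ∃ K, LipschitzWith K f := by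
  obtain ⟨B, hB⟩ := hc.exists_bound_of_continuous hf.continuous
  have hB' : ∀ u v, edist (f u) (f v) ≤ ENNReal.ofReal (2 * B) := fun u v ↦ by
    rw [edist_dist, Real.dist_eq]
    refine ENNReal.ofReal_le_ofReal ((abs_sub _ _).trans ?_)
    have hu := hB u
    have hv := hB v
    rw [Real.norm_eq_abs] at hu hv
    linarith
  have key : ∃ C : NNReal, ∀ u ∈ tsupport f, ∀ v, edist (f u) (f v) ≤ C * edist u v := by
    refine hc.isCompact.induction_on (p := fun s ↦ ∃ C : NNReal, ∀ u ∈ s, ∀ v,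
      edist (f u) (f v) ≤ C * edist u v) ⟨0, by simp⟩ ?_ ?_ ?_
    · rintro s t hst ⟨C, hC⟩
      exact ⟨C, fun u hu ↦ hC u (hst hu)⟩
    · rintro s t ⟨C, hC⟩ ⟨D, hD⟩
      refine ⟨max C D, fun u hu v ↦ ?_⟩
      rcases hu with hu | hu
      · exact (hC u hu v).trans (by gcongr; exact le_max_left _ _)
      · exact (hD u hu v).trans (by gcongr; exact le_max_right _ _)
    · intro x _
      obtain ⟨K, t, ht, hK⟩ := hf x
      obtain ⟨ε, hε, hεt⟩ := EMetric.mem_nhds_iff.1 ht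
      obtain ⟨δ, hδ0, hδε⟩ : ∃ δ : NNReal, 0 < δ ∧ (δ : ℝ≥0∞) + δ ≤ ε := by
        obtain ⟨δ, hδ0, hδ⟩ := ENNReal.lt_iff_exists_nnreal_btwn.1 (ENNReal.half_pos hε.ne')
        exact ⟨δ, by exact_mod_cast hδ0, (add_le_add hδ.le hδ.le).trans (ENNReal.add_halves ε).le⟩
      refine ⟨Metric.eball x δ, mem_nhdsWithin_of_mem_nhds
        (Metric.eball_mem_nhds x (by exact_mod_cast hδ0)), max K (Real.toNNReal (2 * B) / δ),
        fun u hu v ↦ ?_⟩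
      have hux : edist u x < δ := hu
      rcases lt_or_ge (edist u v) δ with huv | huv
      · have hut : u ∈ t := hεt (hux.trans_le (le_self_add.trans hδε))
        have hvt : v ∈ t := hεt (by
          refine lt_of_lt_of_le ?_ hδε
          calc edist v x ≤ edist v u + edist u x := edist_triangle _ _ _
            _ < δ + δ := ENNReal.add_lt_add (by rwa [edist_comm]) hux)
        exact (hK hut hvt).trans (by gcongr; exact le_max_left _ _)
      · calc edist (f u) (f v) ≤ ENNReal.ofReal (2 * B) := hB' u v
          _ = (Real.toNNReal (2 * B) / δ : NNReal) * δ := by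
            rw [← ENNReal.coe_mul, div_mul_cancel₀ _ hδ0.ne']; rfl
          _ ≤ _ := by gcongr; exact le_max_right _ _
  obtain ⟨C, hC⟩ := key
  refine ⟨C, fun u v ↦ ?_⟩
  by_cases hu : u ∈ tsupport f
  · exact hC u hu v
  by_cases hv : v ∈ tsupport f
  · rw [edist_comm (f u), edist_comm u]
    exact hC v hv u
  · simp [image_eq_zero_of_notMem_tsupport hu, image_eq_zero_of_notMem_tsupport hv]

/-! ### Positivity of the Riemannian volume on open sets. -/

section Manifold

lemma isContinuousRiemannianBundle_tangentSpace (E : Type*) [NormedAddCommGroup E]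
    [InnerProductSpace ℝ E] (M : Type*) [TopologicalSpace M] [ChartedSpace E M]
    [IsManifold 𝓘(ℝ, E) ∞ M] [RiemannianBundle (fun x : M ↦ TangentSpace 𝓘(ℝ, E) x)]
    [h : IsContMDiffRiemannianBundle 𝓘(ℝ, E) ∞ E (fun x : M ↦ TangentSpace 𝓘(ℝ, E) x)] :
    IsContinuousRiemannianBundle E (fun x : M ↦ TangentSpace 𝓘(ℝ, E) x) := by
  obtain ⟨g, hg, hg'⟩ := h.exists_contMDiff
  exact ⟨g, hg.continuous, hg'⟩

variable (E : Type*) [NormedAddCommGroup E] [InnerProductSpace ℝ E]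
  {M : Type*} [EMetricSpace M] [ChartedSpace E M] [IsManifold 𝓘(ℝ, E) ∞ M]
  [RiemannianBundle (fun x : M ↦ TangentSpace 𝓘(ℝ, E) x)]

/-- The matrix is the Gram matrix of the image of a basis under an invertible differential. -/
lemma det_metricMatrix_pos [FiniteDimensional ℝ E] (p : M) {y : E}
    (hy : y ∈ (extChartAt 𝓘(ℝ, E) p).target) : 0 < (metricMatrix E p y).det := by
  have hinv : (mfderiv 𝓘(ℝ, E) 𝓘(ℝ, E) (extChartAt 𝓘(ℝ, E) p).symm y).IsInvertible := by
    have := isInvertible_mfderivWithin_extChartAt_symm hy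
    simpa using this
  have hli : LinearIndependent ℝ fun i ↦
      mfderiv 𝓘(ℝ, E) 𝓘(ℝ, E) (extChartAt 𝓘(ℝ, E) p).symm y (stdOrthonormalBasis ℝ E i) := by
    have := (stdOrthonormalBasis ℝ E).toBasis.linearIndependent
    exact this.map' (mfderiv 𝓘(ℝ, E) 𝓘(ℝ, E) (extChartAt 𝓘(ℝ, E) p).symm y).toLinearMap
      (LinearMap.ker_eq_bot.2 hinv.injective)
  exact (Matrix.posDef_gram_of_linearIndependent hli).det_pos

variable [IsContMDiffRiemannianBundle 𝓘(ℝ, E) ∞ E (fun x : M ↦ TangentSpace 𝓘(ℝ, E) x)]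

lemma continuousOn_metricMatrix [FiniteDimensional ℝ E] (p : M) :
    ContinuousOn (metricMatrix E p) (extChartAt 𝓘(ℝ, E) p).target := by
  have := isContinuousRiemannianBundle_tangentSpace E M
  have hopen : IsOpen (extChartAt 𝓘(ℝ, E) p).target := isOpen_extChartAt_target p
  have hsec : ∀ v : E, ContinuousOn (fun y ↦ (TotalSpace.mk ((extChartAt 𝓘(ℝ, E) p).symm y)
      (mfderiv 𝓘(ℝ, E) 𝓘(ℝ, E) (extChartAt 𝓘(ℝ, E) p).symm y v) : TangentBundle 𝓘(ℝ, E) M))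
      (extChartAt 𝓘(ℝ, E) p).target := fun v ↦ by
    have h1 := (contMDiffOn_extChartAt_symm (I := 𝓘(ℝ, E)) (n := 1) p).continuousOn_tangentMapWithin
      le_rfl hopen.uniqueMDiffOn
    have h2 : Continuous fun y : E ↦ (TotalSpace.mk y v : TangentBundle 𝓘(ℝ, E) E) := by
      have : (fun y : E ↦ (TotalSpace.mk y v : TangentBundle 𝓘(ℝ, E) E)) =
          (tangentBundleModelSpaceHomeomorph 𝓘(ℝ, E)).symm ∘ fun y ↦ (y, v) := rfl
      rw [this]
      exact (Homeomorph.continuous _).comp (by fun_prop)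
    refine (h1.comp h2.continuousOn fun y hy ↦ hy).congr fun y hy ↦ ?_
    simp only [Function.comp_apply, tangentMapWithin]
    rw [mfderivWithin_of_isOpen hopen hy]
  refine continuousOn_pi.2 fun i ↦ continuousOn_pi.2 fun j ↦ ?_
  exact (hsec _).inner_bundle (hsec _)

variable [FiniteDimensional ℝ E] [MeasurableSpace E] [BorelSpace E] [MeasurableSpace M]
   [BorelSpace M]

lemma chartVolume_pos {p : M} {U : Set M} (hU : IsOpen U) (hp : p ∈ U) :
    0 < chartVolume E p U := by
  set T := (extChartAt 𝓘(ℝ, E) p).target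
  have hT : IsOpen T := isOpen_extChartAt_target p
  have hcont : ContinuousOn (extChartAt 𝓘(ℝ, E) p).symm T := continuousOn_extChartAt_symm p
  have hV : IsOpen (T ∩ (extChartAt 𝓘(ℝ, E) p).symm ⁻¹' U) := hcont.isOpen_inter_preimage hT hU
  have hVne : (T ∩ (extChartAt 𝓘(ℝ, E) p).symm ⁻¹' U).Nonempty :=
    ⟨extChartAt 𝓘(ℝ, E) p p, mem_extChartAt_target p, by simpa using hp⟩
  set d : E → ℝ≥0∞ := fun y ↦ ENNReal.ofReal (Real.sqrt (metricMatrix E p y).det)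
  have hd : ContinuousOn d T := ENNReal.continuous_ofReal.comp_continuousOn
    ((continuous_id.matrix_det.comp_continuousOn (continuousOn_metricMatrix E p)).sqrt)
  have hae : AEMeasurable (extChartAt 𝓘(ℝ, E) p).symm (((volume : Measure E).restrict T).withDensity d) :=
    (hcont.aemeasurable hT.measurableSet).mono_ac (withDensity_absolutelyContinuous _ _)
  have h1 : ∫⁻ y in T ∩ (extChartAt 𝓘(ℝ, E) p).symm ⁻¹' U, d y ≤ chartVolume E p U := by
    rw [chartVolume, Measure.map_apply_of_aemeasurable hae hU.measurableSet]
    refine le_trans ?_ (measure_mono (Set.inter_subset_right (s := T)))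
    rw [withDensity_apply _ hV.measurableSet, Measure.restrict_restrict hV.measurableSet,
      Set.inter_eq_left.2 Set.inter_subset_left]
  refine lt_of_lt_of_le (pos_iff_ne_zero.2 fun h0 ↦ ?_) h1
  rw [lintegral_eq_zero_iff' ((hd.mono Set.inter_subset_left).aemeasurable hV.measurableSet),
    Filter.EventuallyEq, ae_restrict_iff' hV.measurableSet] at h0
  refine (hV.measure_pos volume hVne).ne' (measure_mono_null (fun y hy ↦ ?_) h0)
  intro hc
  have := hc hy
  simp only [d, Pi.zero_apply, ENNReal.ofReal_eq_zero] at this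
  exact absurd this (not_le.2 (Real.sqrt_pos.2 (det_metricMatrix_pos E p hy.1)))

lemma riemannianVolume_pos {U : Set M} (hU : IsOpen U) (hne : U.Nonempty) :
    0 < riemannianVolume E M U := by
  obtain ⟨p, hp⟩ := hne
  exact (chartVolume_pos E hU hp).trans_le (Measure.le_iff'.1 (le_iSup (chartVolume E) p) U)

end Manifold

/-! ### The chain rule for `gradNorm`. -/

section Gradient

variable (E : Type*) [NormedAddCommGroup E] [InnerProductSpace ℝ E]
  {M : Type*} [EMetricSpace M] [ChartedSpace E M]
  [RiemannianBundle (fun x : M ↦ TangentSpace 𝓘(ℝ, E) x)]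

lemma ContinuousLinearMap.norm_eq_abs_mul_of_forall {F : Type*} [SeminormedAddCommGroup F]
    [NormedSpace ℝ F] {L L' : F →L[ℝ] ℝ} {c : ℝ} (h : ∀ v, L' v = c * L v) :
    ‖L'‖ = |c| * ‖L‖ := by
  rw [show L' = c • L from ContinuousLinearMap.ext h, norm_smul, Real.norm_eq_abs]

/-- The two differentials take values in tangent spaces of ℝ at different points; naming them as
functionals `L`, `L'` into ℝ allows them to be compared. -/
lemma gradNorm_eq_abs_mul_of_forall {f f' : M → ℝ} {c : ℝ} {x : M}
    {L L' : TangentSpace 𝓘(ℝ, E) x →L[ℝ] ℝ} (hL : mfderiv 𝓘(ℝ, E) 𝓘(ℝ, ℝ) f x = L)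
    (hL' : mfderiv 𝓘(ℝ, E) 𝓘(ℝ, ℝ) f' x = L') (h : ∀ v, L' v = c * L v) :
    gradNorm E f' x = |c| * gradNorm E f x := by
  subst hL hL'
  exact ContinuousLinearMap.norm_eq_abs_mul_of_forall (F := TangentSpace 𝓘(ℝ, E) x) h

variable [IsManifold 𝓘(ℝ, E) ∞ M]
  [IsContMDiffRiemannianBundle 𝓘(ℝ, E) ∞ E (fun x : M ↦ TangentSpace 𝓘(ℝ, E) x)]
  [IsRiemannianManifold 𝓘(ℝ, E) M]

/-- The Riemannian distance is locally bounded by a multiple of the chart distance, so ρ read in the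
chart varies by O(|y - e x|), and g turns this into o(|y - e x|). No differentiability of ρ is
needed. -/
lemma hasMFDerivAt_comp_of_hasDerivAt_zero {ρ : M → ℝ} (hρ : LocallyLipschitz ρ) {g : ℝ → ℝ}
    {x : M} (hg : HasDerivAt g 0 (ρ x)) :
    HasMFDerivAt 𝓘(ℝ, E) 𝓘(ℝ, ℝ) (g ∘ ρ) x 0 := by
  have := isContinuousRiemannianBundle_tangentSpace E M
  set e := extChartAt 𝓘(ℝ, E) x
  have hex : e.symm (e x) = x := extChartAt_to_inv x
  have hsymm : Tendsto e.symm (𝓝 (e x)) (𝓝 x) := by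
    have := continuousAt_extChartAt_symm (I := 𝓘(ℝ, E)) x
    rwa [ContinuousAt, hex] at this
  obtain ⟨C, -, hC⟩ := eventually_riemannianEDist_le_edist_extChartAt 𝓘(ℝ, E) x
  obtain ⟨K, t, ht, hK⟩ := hρ x
  have hO : (fun y ↦ ρ (e.symm y) - ρ x) =O[𝓝 (e x)] fun y ↦ y - e x := by
    refine Asymptotics.IsBigO.of_bound (K * C) ?_
    filter_upwards [hsymm hC, hsymm ht, extChartAt_target_mem_nhds (I := 𝓘(ℝ, E)) x]
      with y hy hyt hy'
    have h1 : edist (ρ x) (ρ (e.symm y)) ≤ ((K * C : NNReal) : ℝ≥0∞) * edist (e x) y := by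
      refine (hK (mem_of_mem_nhds ht) hyt).trans ?_
      rw [ENNReal.coe_mul, mul_assoc]
      gcongr
      rw [IsRiemannianManifold.out (I := 𝓘(ℝ, E)) x (e.symm y)]
      have hy2 : riemannianEDist 𝓘(ℝ, E) x (e.symm y) ≤ C * edist (e x) (e (e.symm y)) := hy
      rwa [e.right_inv hy'] at hy2
    rw [edist_dist, edist_dist, ← ENNReal.ofReal_coe_nnreal, ← ENNReal.ofReal_mul (by positivity),
      ENNReal.ofReal_le_ofReal_iff (by positivity), dist_comm, dist_eq_norm, dist_comm,
      dist_eq_norm] at h1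
    exact_mod_cast h1
  have hcont : Tendsto (fun y ↦ ρ (e.symm y)) (𝓝 (e x)) (𝓝 (ρ x)) :=
    (hρ.continuous.tendsto x).comp hsymm
  refine ⟨hg.continuousAt.comp hρ.continuous.continuousAt, ?_⟩
  have hfd : HasFDerivAt (fun y ↦ g (ρ (e.symm y))) (0 : E →L[ℝ] ℝ) (e x) := by
    refine HasFDerivAt.of_isLittleO ?_
    have h1 := (hasDerivAt_iff_isLittleO.1 hg).comp_tendsto hcont
    simp only [smul_zero, sub_zero, Function.comp_def] at h1
    simpa [hex] using h1.trans_isBigO hO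
  exact (hfd.hasFDerivWithinAt : HasFDerivWithinAt _ _ (Set.range 𝓘(ℝ, E)) _)

/-- This holds at every point, so Rademacher's theorem is not needed. Where ρ is not differentiable
its `mfderiv` is 0 by convention. If g' ≠ 0, a local inverse of g shows that g ∘ ρ is not
differentiable either; if g' = 0, g ∘ ρ has zero differential regardless. -/
lemma gradNorm_comp {ρ : M → ℝ} (hρ : LocallyLipschitz ρ) {g : ℝ → ℝ} {g' : ℝ} {x : M}
    (hg : HasStrictDerivAt g g' (ρ x)) :
    gradNorm E (g ∘ ρ) x = |g'| * gradNorm E ρ x := by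
  rcases eq_or_ne g' 0 with rfl | hg'
  · exact gradNorm_eq_abs_mul_of_forall E rfl
      (hasMFDerivAt_comp_of_hasDerivAt_zero E hρ hg.hasDerivAt).mfderiv fun v ↦ (zero_mul _).symm
  by_cases hd : MDifferentiableAt 𝓘(ℝ, E) 𝓘(ℝ, ℝ) ρ x
  · have h1 : HasMFDerivAt 𝓘(ℝ, ℝ) 𝓘(ℝ, ℝ) g (ρ x) (ContinuousLinearMap.toSpanSingleton ℝ g') :=
      hg.hasDerivAt.hasFDerivAt.hasMFDerivAt
    exact gradNorm_eq_abs_mul_of_forall E rfl (h1.comp x hd.hasMFDerivAt).mfderiv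
      fun v ↦ mul_comm (_ : ℝ) _
  · have hd' : ¬ MDifferentiableAt 𝓘(ℝ, E) 𝓘(ℝ, ℝ) (g ∘ ρ) x := fun hc ↦ hd <| by
      have h1 : MDifferentiableAt 𝓘(ℝ, ℝ) 𝓘(ℝ, ℝ) (hg.localInverse g g' (ρ x) hg') (g (ρ x)) :=
        (hg.to_localInverse hg').hasDerivAt.differentiableAt.mdifferentiableAt
      refine (h1.comp x hc).congr_of_eventuallyEq ?_
      have := hg.eventually_left_inverse hg'
      filter_upwards [hρ.continuous.continuousAt.eventually this] with y hy using hy.symm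
    exact gradNorm_eq_abs_mul_of_forall E (mfderiv_zero_of_not_mdifferentiableAt hd)
      (mfderiv_zero_of_not_mdifferentiableAt hd') fun v ↦ (mul_zero g').symm

end Gradient

/-! ### From the Dirichlet eigenvalue to an energy inequality. -/

section Energy

variable (E : Type*) [NormedAddCommGroup E] [InnerProductSpace ℝ E] [FiniteDimensional ℝ E]
  [MeasurableSpace E] [BorelSpace E]
  {M : Type*} [EMetricSpace M] [ChartedSpace E M] [IsManifold 𝓘(ℝ, E) ∞ M]
  [RiemannianBundle (fun x : M ↦ TangentSpace 𝓘(ℝ, E) x)]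
  [IsContMDiffRiemannianBundle 𝓘(ℝ, E) ∞ E (fun x : M ↦ TangentSpace 𝓘(ℝ, E) x)]
  [IsRiemannianManifold 𝓘(ℝ, E) M] [MeasurableSpace M] [BorelSpace M]

/-- The test function `ψ(ρ / r)` in the Rayleigh quotient of `{ρ < r}`. -/
lemma dirichletEigenvalue_mul_lintegral_le {ρ : M → ℝ} (hρ : IsLipschitzExhaustion E ρ)
    {ψ : ℝ → ℝ} (hψ : ContDiff ℝ 1 ψ) (hψ1 : ψ 1 = 0) {r : ℝ} (hr : 0 < r) :
    ENNReal.ofReal (r ^ 2) * dirichletEigenvalue E {x | ρ x < r} *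
        ∫⁻ x in {x | ρ x < r}, ENNReal.ofReal (ψ (ρ x / r) ^ 2) ∂(riemannianVolume E M) ≤
      ∫⁻ x in {x | ρ x < r}, ENNReal.ofReal (deriv ψ (ρ x / r) ^ 2) ∂(riemannianVolume E M) := by
  have hcont := hρ.locallyLipschitz.continuous
  have hopen : IsOpen {x | ρ x < r} := isOpen_lt hcont continuous_const
  -- Capping the argument at 1, where ψ vanishes, extends ψ(ρ/r) by zero outside {ρ < r} and keeps
  -- it locally Lipschitz.
  set φ : M → ℝ := fun x ↦ ψ (min (ρ x / r) 1) with hφ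
  have hφr : ∀ x ∈ {x | ρ x < r}, φ x = ψ (ρ x / r) := fun x hx ↦ by
    simp only [hφ]
    rw [min_eq_left ((div_lt_one hr).2 hx).le]
  have hden : ∫⁻ x in {x | ρ x < r}, ENNReal.ofReal (ψ (ρ x / r) ^ 2) ∂(riemannianVolume E M) =
      ∫⁻ x in {x | ρ x < r}, ENNReal.ofReal (φ x ^ 2) ∂(riemannianVolume E M) :=
    setLIntegral_congr_fun hopen.measurableSet fun x hx ↦ by rw [hφr x hx]
  rw [hden]
  rcases eq_or_ne φ 0 with h0 | h0
  · simp [h0]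
  have hsupp : Function.support φ ⊆ {x | ρ x < r} := fun x hx ↦ by
    by_contra hc
    refine hx ?_
    simp only [Set.mem_ofPred_eq, not_lt] at hc
    simp only [hφ]
    rw [min_eq_right ((one_le_div hr).2 hc), hψ1]
  have hcomp : HasCompactSupport φ :=
    (hρ.isCompact_closure r hr).of_isClosed_subset (isClosed_tsupport φ) (closure_mono hsupp)
  have hφlip : LocallyLipschitz φ := by
    refine hψ.locallyLipschitz.comp (LocallyLipschitz.min_const ?_ 1)
    have : LipschitzWith ‖r⁻¹‖₊ fun t : ℝ ↦ t / r := by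
      simpa [div_eq_mul_inv, mul_comm, smul_eq_mul] using lipschitzWith_smul (α := ℝ) (β := ℝ) r⁻¹
    exact this.locallyLipschitz.comp hρ.locallyLipschitz
  have hle := ENNReal.mul_le_of_le_div (show dirichletEigenvalue E {x | ρ x < r} ≤
    (∫⁻ x in {x | ρ x < r}, ENNReal.ofReal (gradNorm E φ x ^ 2) ∂(riemannianVolume E M)) /
      (∫⁻ x in {x | ρ x < r}, ENNReal.ofReal (φ x ^ 2) ∂(riemannianVolume E M)) from
    iInf₂_le φ ⟨hφlip.exists_lipschitzWith_of_hasCompactSupport hcomp, hcomp, closure_mono hsupp, h0⟩)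
  rw [mul_assoc]
  refine (mul_le_mul_right hle _).trans ?_
  rw [← lintegral_const_mul' _ _ ENNReal.ofReal_ne_top]
  refine lintegral_mono_ae ((ae_restrict_iff' hopen.measurableSet).2 ?_)
  filter_upwards [hρ.gradNorm_le_one] with x hx1 hx
  rw [← ENNReal.ofReal_mul (sq_nonneg r)]
  refine ENNReal.ofReal_le_ofReal ?_
  have hg : HasStrictDerivAt (fun t ↦ ψ (t / r)) (deriv ψ (ρ x / r) * (1 / r)) (ρ x) :=
    HasStrictDerivAt.comp (ρ x) (hψ.contDiffAt.hasStrictDerivAt one_ne_zero)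
      ((hasStrictDerivAt_id (ρ x)).div_const r)
  have hev : φ =ᶠ[𝓝 x] (fun t ↦ ψ (t / r)) ∘ ρ := by
    filter_upwards [hopen.mem_nhds hx] with y hy using hφr y hy
  have hgrad : gradNorm E φ x = gradNorm E ((fun t ↦ ψ (t / r)) ∘ ρ) x := by
    have := gradNorm_eq_abs_mul_of_forall E (f := (fun t ↦ ψ (t / r)) ∘ ρ) (f' := φ) (c := 1)
      rfl hev.mfderiv_eq fun v ↦ (one_mul _).symm
    rwa [abs_one, one_mul] at this
  have hx0 : 0 ≤ gradNorm E ρ x := norm_nonneg (E := TangentSpace 𝓘(ℝ, E) x →L[ℝ] ℝ) _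
  rw [hgrad, gradNorm_comp E hρ.locallyLipschitz hg, mul_pow, sq_abs, mul_pow]
  have h1 : gradNorm E ρ x ^ 2 ≤ 1 := pow_le_one₀ hx0 hx1
  calc r ^ 2 * (deriv ψ (ρ x / r) ^ 2 * (1 / r) ^ 2 * gradNorm E ρ x ^ 2)
      = deriv ψ (ρ x / r) ^ 2 * gradNorm E ρ x ^ 2 := by field_simp
    _ ≤ deriv ψ (ρ x / r) ^ 2 := mul_le_of_le_one_right (sq_nonneg _) h1

end Energy

/-! ### Iteration over scales and Mellin averaging. -/

/-- A monotone function that gains the factor `δ ^ (-κ)` from `δ R` to `R` grows at least like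
`R ^ κ`. -/
lemma exists_mul_rpow_le_of_iterate {G : ℝ → ℝ} (hG : Monotone G) {δ κ T : ℝ} (hδ0 : 0 < δ)
    (hδ1 : δ < 1) (hκ : 0 < κ) (hT : 0 < T) (hGT : 0 < G T)
    (h : ∀ R, T ≤ R → G (δ * R) ≤ δ ^ κ * G R) :
    ∃ c, 0 < c ∧ ∀ R, T ≤ R → c * R ^ κ ≤ G R := by
  have hδκ : 0 < δ ^ κ := Real.rpow_pos_of_pos hδ0 κ
  have hTδ : 0 < (T / δ) ^ κ := Real.rpow_pos_of_pos (div_pos hT hδ0) κ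
  refine ⟨G T / (T / δ) ^ κ, by positivity, ?_⟩
  -- Here n bounds the number of contractions by δ that bring R down to at most T/δ, where
  -- monotonicity alone suffices.
  have key : ∀ n : ℕ, ∀ R, T ≤ R → R * δ ^ n ≤ T / δ → G T / (T / δ) ^ κ * R ^ κ ≤ G R := by
    intro n
    induction n with
    | zero =>
      intro R hR hn
      rw [pow_zero, mul_one] at hn
      have : R ^ κ ≤ (T / δ) ^ κ := Real.rpow_le_rpow (hT.le.trans hR) hn hκ.le
      calc G T / (T / δ) ^ κ * R ^ κ ≤ G T / (T / δ) ^ κ * (T / δ) ^ κ := by gcongr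
        _ = G T := div_mul_cancel₀ _ hTδ.ne'
        _ ≤ G R := hG hR
    | succ n ih =>
      intro R hR hn
      have hR0 : 0 < R := hT.trans_le hR
      rcases le_or_gt T (δ * R) with hc | hc
      · have h1 := ih (δ * R) hc (by rw [pow_succ] at hn; linarith)
        rw [Real.mul_rpow hδ0.le hR0.le] at h1
        have h2 := h1.trans (h R hR)
        rw [mul_left_comm] at h2
        exact le_of_mul_le_mul_left h2 hδκ
      · refine ih R hR ?_
        have : R ≤ T / δ := by rw [le_div_iff₀ hδ0]; linarith
        exact (mul_le_of_le_one_right hR0.le (pow_le_one₀ hδ0.le hδ1.le)).trans this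
  intro R hR
  have hR0 : 0 < R := hT.trans_le hR
  obtain ⟨n, hn⟩ := exists_pow_lt_of_lt_one (show 0 < T / δ / R by positivity) hδ1
  refine key n R hR ?_
  rw [lt_div_iff₀ hR0] at hn
  linarith

lemma integral_sq_div_mul_rpow {g : ℝ → ℝ} (hg : Continuous g) (μ : ℝ) {t R : ℝ} (ht : 0 < t)
    (htR : t ≤ R) :
    ∫ r in t..R, g (t / r) ^ 2 * r ^ (-μ - 1) =
      t ^ (-μ) * ∫ s in (t / R)..1, g s ^ 2 * s ^ (μ - 1) := by
  have hu : Set.uIcc t R = Set.Icc t R := Set.uIcc_of_le htR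
  have hpos : ∀ r ∈ Set.uIcc t R, 0 < r := fun r hr ↦ ht.trans_le (hu ▸ hr).1
  have hsub := intervalIntegral.integral_comp_mul_deriv' (a := t) (b := R)
    (f := fun r ↦ t / r) (f' := fun r ↦ -(t / r ^ 2)) (g := fun s ↦ g s ^ 2 * s ^ (μ - 1))
    (fun r hr ↦ by
      have := (hasDerivAt_inv (hpos r hr).ne').const_mul t
      exact this.congr_deriv (by rw [div_eq_mul_inv]; ring))
    (ContinuousOn.neg (continuousOn_const.div (by fun_prop)
      fun r hr ↦ (pow_pos (hpos r hr) 2).ne'))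
    (by
      refine (hg.pow 2).continuousOn.mul (continuousOn_id.rpow_const ?_)
      rintro s ⟨r, hr, rfl⟩
      exact Or.inl (div_pos ht (hpos r hr)).ne')
  rw [div_self ht.ne', intervalIntegral.integral_symm (t / R) 1] at hsub
  have : ∫ r in t..R, g (t / r) ^ 2 * r ^ (-μ - 1) =
      ∫ r in t..R, -t ^ (-μ) * (((fun s ↦ g s ^ 2 * s ^ (μ - 1)) ∘ fun r ↦ t / r) r *
        -(t / r ^ 2)) := by
    refine intervalIntegral.integral_congr fun r hr ↦ ?_
    have hr0 := hpos r hr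
    simp only [Function.comp_apply]
    rw [Real.div_rpow ht.le hr0.le, Real.rpow_neg ht.le, Real.rpow_sub_one ht.ne',
      Real.rpow_sub_one hr0.ne', Real.rpow_sub_one hr0.ne', Real.rpow_neg hr0.le]
    have h1 := (Real.rpow_pos_of_pos ht μ).ne'
    have h2 := (Real.rpow_pos_of_pos hr0 μ).ne'
    field_simp
  rw [this, intervalIntegral.integral_const_mul, hsub]
  ring

lemma setLIntegral_Ioo_sq_div_mul_rpow {g : ℝ → ℝ} (hg : Continuous g) (μ : ℝ) {t R : ℝ}
    (ht : 0 < t) (htR : t ≤ R) :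
    ∫⁻ r in Set.Ioo t R, ENNReal.ofReal (g (t / r) ^ 2 * r ^ (-μ - 1)) =
      ENNReal.ofReal (t ^ (-μ) * ∫ s in (t / R)..1, g s ^ 2 * s ^ (μ - 1)) := by
  rw [← integral_sq_div_mul_rpow hg μ ht htR, intervalIntegral.integral_of_le htR,
    integral_Ioc_eq_integral_Ioo, ofReal_integral_eq_lintegral_ofReal]
  · refine (ContinuousOn.integrableOn_Icc ?_).mono_set Set.Ioo_subset_Icc_self
    have hne : ∀ r ∈ Set.Icc t R, r ≠ 0 := fun r hr ↦ (ht.trans_le hr.1).ne'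
    exact ((hg.comp_continuousOn (continuousOn_const.div continuousOn_id hne)).pow 2).mul
      (continuousOn_id.rpow_const fun r hr ↦ Or.inl (hne r hr))
  · refine (ae_restrict_iff' measurableSet_Ioo).2 (Eventually.of_forall fun r hr ↦ ?_)
    exact mul_nonneg (sq_nonneg _) (Real.rpow_nonneg (ht.trans hr.1).le _)

/-- Mellin averaging in `r` of the integrals `∫_{t < r} g(t / r) ^ 2 dm(t)`. -/
lemma lintegral_mellin_swap (m : Measure ℝ) [SFinite m] {g : ℝ → ℝ} (hg : Continuous g)
    (μ a R : ℝ) (ha : 0 ≤ a) :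
    ∫⁻ r in Set.Ioo a R, ENNReal.ofReal (r ^ (-μ - 1)) *
        ∫⁻ t in Set.Iio r, ENNReal.ofReal (g (t / r) ^ 2) ∂m =
      ∫⁻ t in Set.Iio R, (∫⁻ r in Set.Ioo (max a t) R,
        ENNReal.ofReal (g (t / r) ^ 2 * r ^ (-μ - 1))) ∂m := by
  set k : ℝ → ℝ → ℝ≥0∞ := fun r t ↦ (Set.Iio r).indicator
    (fun t ↦ ENNReal.ofReal (g (t / r) ^ 2 * r ^ (-μ - 1))) t with hk
  have hmeas : Measurable (Function.uncurry k) := by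
    have h1 : Measurable fun p : ℝ × ℝ ↦ ENNReal.ofReal (g (p.2 / p.1) ^ 2 * p.1 ^ (-μ - 1)) := by
      have := hg.measurable
      fun_prop
    have h2 : Function.uncurry k = {p : ℝ × ℝ | p.2 < p.1}.indicator
        fun p ↦ ENNReal.ofReal (g (p.2 / p.1) ^ 2 * p.1 ^ (-μ - 1)) := by
      ext p
      simp [k, Function.uncurry, Set.indicator]
    rw [h2]
    exact h1.indicator (measurableSet_lt measurable_snd measurable_fst)
  have h1 : ∫⁻ r in Set.Ioo a R, ENNReal.ofReal (r ^ (-μ - 1)) *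
        ∫⁻ t in Set.Iio r, ENNReal.ofReal (g (t / r) ^ 2) ∂m =
      ∫⁻ r in Set.Ioo a R, ∫⁻ t, k r t ∂m := by
    refine setLIntegral_congr_fun measurableSet_Ioo fun r hr ↦ ?_
    simp only [hk]
    rw [lintegral_indicator measurableSet_Iio, ← lintegral_const_mul' _ _ ENNReal.ofReal_ne_top]
    refine lintegral_congr fun t ↦ ?_
    rw [← ENNReal.ofReal_mul (Real.rpow_nonneg (ha.trans hr.1.le) _), mul_comm]
  rw [h1, lintegral_lintegral_swap hmeas.aemeasurable, ← lintegral_indicator measurableSet_Iio]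
  refine lintegral_congr fun t ↦ ?_
  rw [← lintegral_indicator measurableSet_Ioo]
  simp only [Set.indicator_apply, Set.mem_Iio]
  split_ifs with htR
  · rw [← lintegral_indicator measurableSet_Ioo]
    refine lintegral_congr fun r ↦ ?_
    simp only [hk, Set.indicator_apply, Set.mem_Ioo, Set.mem_Iio, max_lt_iff]
    split_ifs <;> first | rfl | (exfalso; tauto)
  · refine (lintegral_congr fun r ↦ ?_).trans lintegral_zero
    simp only [hk, Set.indicator_apply, Set.mem_Ioo, Set.mem_Iio]
    split_ifs with h2 h3
    · exact absurd (h3.trans h2.2) htR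
    · rfl
    · rfl

lemma setLIntegral_Ioi_rpow_lt_top {μ a : ℝ} (hμ : 0 < μ) (ha : 0 < a) :
    ∫⁻ r in Set.Ioi a, ENNReal.ofReal (r ^ (-μ - 1)) < ⊤ :=
  (integrableOn_Ioi_rpow_of_lt (by linarith) ha).lintegral_lt_top

lemma integral_sq_mul_rpow_le {μ : ℝ} (hμ : 0 < μ) {g : ℝ → ℝ} (hg : Continuous g) {x : ℝ}
    (hx0 : 0 ≤ x) (hx1 : x ≤ 1) :
    ∫ s in x..1, g s ^ 2 * s ^ (μ - 1) ≤ ∫ s in (0 : ℝ)..1, g s ^ 2 * s ^ (μ - 1) := by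
  refine intervalIntegral.integral_mono_interval hx0 hx1 le_rfl ?_
    (intervalIntegrable_sq_mul_rpow hμ hg.continuousOn)
  refine (ae_restrict_iff' measurableSet_Ioc).2 (Eventually.of_forall fun s hs ↦ ?_)
  exact mul_nonneg (sq_nonneg _) (Real.rpow_nonneg hs.1.le _)

lemma integral_sq_mul_rpow_anti {μ ν : ℝ} (hμν : μ ≤ ν) {g : ℝ → ℝ} (hg : Continuous g) {x y : ℝ}
    (hx0 : 0 < x) (hxy : x ≤ y) (hy1 : y ≤ 1) :
    ∫ s in y..1, g s ^ 2 * s ^ (ν - 1) ≤ ∫ s in x..1, g s ^ 2 * s ^ (μ - 1) := by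
  have hint : ∀ (z κ : ℝ), 0 < z → z ≤ 1 →
      IntervalIntegrable (fun s ↦ g s ^ 2 * s ^ (κ - 1)) volume z 1 := fun z κ hz hz1 ↦ by
    refine ContinuousOn.intervalIntegrable ((hg.pow 2).continuousOn.mul
      (continuousOn_id.rpow_const fun s hs ↦ Or.inl ?_))
    rw [Set.uIcc_of_le hz1] at hs
    exact (hz.trans_le hs.1).ne'
  have hy0 := hx0.trans_le hxy
  calc ∫ s in y..1, g s ^ 2 * s ^ (ν - 1) ≤ ∫ s in y..1, g s ^ 2 * s ^ (μ - 1) := by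
        refine intervalIntegral.integral_mono_on hy1 (hint y ν hy0 hy1) (hint y μ hy0 hy1)
          fun s hs ↦ ?_
        exact mul_le_mul_of_nonneg_left (Real.rpow_le_rpow_of_exponent_ge
          (hy0.trans_le hs.1) hs.2 (by linarith)) (sq_nonneg _)
    _ ≤ ∫ s in x..1, g s ^ 2 * s ^ (μ - 1) := by
        refine intervalIntegral.integral_mono_interval hxy hy1 le_rfl ?_
          (hint x μ hx0 (hxy.trans hy1))
        refine (ae_restrict_iff' measurableSet_Ioc).2 (Eventually.of_forall fun s hs ↦ ?_)
        exact mul_nonneg (sq_nonneg _) (Real.rpow_nonneg (hx0.trans hs.1).le _)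

/-- If `Λ ∫_{t < r} ψ(t / r) ^ 2 dm ≤ ∫_{t < r} ψ'(t / r) ^ 2 dm` for all `r ≥ a`, then the truncated
Mellin moments of `m` satisfy a growth inequality between the scales `δ R` and `R`. -/
lemma mellin_moment_recursion (m : Measure ℝ) [SFinite m] (hneg : m (Set.Iio 0) = 0)
    {ψ ψ' : ℝ → ℝ} (hψ : Continuous ψ) (hψ' : Continuous ψ') {μ ν Λ a δ : ℝ} (hμ : 0 < μ)
    (hμν : μ ≤ ν) (hΛ : 0 ≤ Λ) (ha : 0 < a) (hδ1 : δ < 1)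
    (h : ∀ r, a ≤ r → ENNReal.ofReal Λ * ∫⁻ t in Set.Iio r, ENNReal.ofReal (ψ (t / r) ^ 2) ∂m ≤
      ∫⁻ t in Set.Iio r, ENNReal.ofReal (ψ' (t / r) ^ 2) ∂m) :
    ∃ C : ℝ≥0∞, C ≠ ⊤ ∧ ∀ R, a ≤ R →
      ENNReal.ofReal (Λ * ∫ s in δ..1, ψ s ^ 2 * s ^ (ν - 1)) *
        ∫⁻ t in Set.Ico a (δ * R), ENNReal.ofReal (t ^ (-μ)) ∂m ≤
      C * m (Set.Iio a) + ENNReal.ofReal (∫ s in (0 : ℝ)..1, ψ' s ^ 2 * s ^ (μ - 1)) *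
        ∫⁻ t in Set.Ico a R, ENNReal.ofReal (t ^ (-μ)) ∂m := by
  obtain ⟨S, hS⟩ := isCompact_Icc.exists_bound_of_continuousOn
    (s := Set.Icc (0 : ℝ) 1) (f := fun s ↦ ψ' s ^ 2) (hψ'.pow 2).continuousOn
  refine ⟨ENNReal.ofReal S * ∫⁻ r in Set.Ioi a, ENNReal.ofReal (r ^ (-μ - 1)),
    ENNReal.mul_ne_top ENNReal.ofReal_ne_top (setLIntegral_Ioi_rpow_lt_top hμ ha).ne,
    fun R hR ↦ ?_⟩
  have hR0 : 0 < R := ha.trans_le hR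
  set P : (ℝ → ℝ) → ℝ → ℝ≥0∞ := fun g t ↦ ∫⁻ r in Set.Ioo (max a t) R,
    ENNReal.ofReal (g (t / r) ^ 2 * r ^ (-μ - 1)) with hP
  have hswap : ENNReal.ofReal Λ * ∫⁻ t in Set.Iio R, P ψ t ∂m ≤ ∫⁻ t in Set.Iio R, P ψ' t ∂m := by
    rw [← lintegral_mellin_swap m hψ μ a R ha.le, ← lintegral_mellin_swap m hψ' μ a R ha.le,
      ← lintegral_const_mul' _ _ ENNReal.ofReal_ne_top]
    refine setLIntegral_mono' measurableSet_Ioo fun r hr ↦ ?_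
    rw [mul_left_comm]
    exact mul_le_mul_right (h r hr.1.le) _
  have hPge : ∀ g, ∀ t, a ≤ t → t ≤ R → Continuous g → P g t =
      ENNReal.ofReal (t ^ (-μ) * ∫ s in (t / R)..1, g s ^ 2 * s ^ (μ - 1)) :=
    fun g t hat htR hg ↦ by
      simp only [hP, max_eq_right hat]
      exact setLIntegral_Ioo_sq_div_mul_rpow hg μ (ha.trans_le hat) htR
  -- Only t < δR is kept, so that t/R ≤ δ and the inner integral covers [δ, 1]; since s ≤ 1, raising
  -- the exponent from μ to ν only decreases it.
  have hlow : ENNReal.ofReal (Λ * ∫ s in δ..1, ψ s ^ 2 * s ^ (ν - 1)) *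
        ∫⁻ t in Set.Ico a (δ * R), ENNReal.ofReal (t ^ (-μ)) ∂m ≤
      ENNReal.ofReal Λ * ∫⁻ t in Set.Iio R, P ψ t ∂m := by
    rw [ENNReal.ofReal_mul hΛ, mul_assoc]
    refine mul_le_mul_right ?_ _
    rw [← lintegral_const_mul' _ _ ENNReal.ofReal_ne_top]
    have hsub : Set.Ico a (δ * R) ⊆ Set.Iio R := fun t ht ↦
      ht.2.trans_le (mul_le_of_le_one_left hR0.le hδ1.le)
    refine le_trans (setLIntegral_mono' measurableSet_Ico fun t ht ↦ ?_) (lintegral_mono_set hsub)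
    have ht0 : 0 < t := ha.trans_le ht.1
    have htμ := Real.rpow_nonneg ht0.le (-μ)
    rw [hPge ψ t ht.1 (hsub ht).le hψ, ENNReal.ofReal_mul htμ, mul_comm]
    refine mul_le_mul_right (ENNReal.ofReal_le_ofReal ?_) _
    exact integral_sq_mul_rpow_anti hμν hψ (by positivity) (by rw [div_le_iff₀ hR0]; exact ht.2.le)
      hδ1.le
  -- The mass below a contributes a bound independent of R, because r^(-μ-1) is integrable at
  -- infinity.
  have hup1 : ∫⁻ t in Set.Iio a, P ψ' t ∂m ≤
      ENNReal.ofReal S * (∫⁻ r in Set.Ioi a, ENNReal.ofReal (r ^ (-μ - 1))) * m (Set.Iio a) := by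
    rw [← setLIntegral_const]
    refine lintegral_mono_ae ((ae_restrict_iff' measurableSet_Iio).2 ?_)
    filter_upwards [measure_eq_zero_iff_ae_notMem.1 hneg] with t ht0 hta
    have ht0 : 0 ≤ t := not_lt.1 ht0
    have hta : t < a := hta
    simp only [hP, max_eq_left hta.le]
    rw [← lintegral_const_mul' _ _ ENNReal.ofReal_ne_top]
    refine le_trans (setLIntegral_mono' measurableSet_Ioo fun r hr ↦ ?_)
      (lintegral_mono_set Set.Ioo_subset_Ioi_self)
    have hr0 : 0 < r := ha.trans hr.1
    rw [ENNReal.ofReal_mul (sq_nonneg _)]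
    refine mul_le_mul_left (ENNReal.ofReal_le_ofReal ((le_abs_self _).trans (hS _ ?_))) _
    exact ⟨by positivity, by rw [div_le_one hr0]; exact (hta.trans hr.1).le⟩
  have hup2 : ∫⁻ t in Set.Ico a R, P ψ' t ∂m ≤
      ENNReal.ofReal (∫ s in (0 : ℝ)..1, ψ' s ^ 2 * s ^ (μ - 1)) *
        ∫⁻ t in Set.Ico a R, ENNReal.ofReal (t ^ (-μ)) ∂m := by
    rw [← lintegral_const_mul' _ _ ENNReal.ofReal_ne_top]
    refine setLIntegral_mono' measurableSet_Ico fun t ht ↦ ?_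
    have ht0 : 0 < t := ha.trans_le ht.1
    rw [hPge ψ' t ht.1 ht.2.le hψ', ENNReal.ofReal_mul (Real.rpow_nonneg ht0.le (-μ)), mul_comm]
    refine mul_le_mul_left (ENNReal.ofReal_le_ofReal ?_) _
    exact integral_sq_mul_rpow_le hμ hψ' (by positivity) (by rw [div_le_one hR0]; exact ht.2.le)
  calc _ ≤ ENNReal.ofReal Λ * ∫⁻ t in Set.Iio R, P ψ t ∂m := hlow
    _ ≤ ∫⁻ t in Set.Iio R, P ψ' t ∂m := hswap
    _ ≤ ∫⁻ t in Set.Iio a ∪ Set.Ico a R, P ψ' t ∂m := by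
        rw [Set.Iio_union_Ico_eq_Iio hR]
    _ ≤ ∫⁻ t in Set.Iio a, P ψ' t ∂m + ∫⁻ t in Set.Ico a R, P ψ' t ∂m := lintegral_union_le _ _ _
    _ ≤ _ := add_le_add hup1 hup2

/-! ### Energy inequalities force volume growth. -/

/-- A strict inequality survives cutting the mass integral at a small δ and lowering the energy
exponent slightly. One K then serves all μ ≥ μ₀, as the energy decreases in μ; this uniformity lets
μ be chosen after δ. -/
lemma exists_truncation_of_integral_lt {ν Λ : ℝ} (hν : 0 < ν) {ψ ψ' : ℝ → ℝ} (hψ : Continuous ψ)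
    (hψ' : Continuous ψ')
    (h : ∫ s in (0 : ℝ)..1, ψ' s ^ 2 * s ^ (ν - 1) < Λ * ∫ s in (0 : ℝ)..1, ψ s ^ 2 * s ^ (ν - 1)) :
    ∃ δ μ₀ K : ℝ, 0 < δ ∧ δ < 1 ∧ 0 < μ₀ ∧ μ₀ < ν ∧ 0 < K ∧
      K < Λ * ∫ s in δ..1, ψ s ^ 2 * s ^ (ν - 1) ∧
      ∀ μ, μ₀ ≤ μ → ∫ s in (0 : ℝ)..1, ψ' s ^ 2 * s ^ (μ - 1) ≤ K := by
  obtain ⟨L, hL1, hL2⟩ := exists_between h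
  have hL0 : 0 < L := lt_of_le_of_lt (intervalIntegral.integral_nonneg zero_le_one fun s hs ↦
    mul_nonneg (sq_nonneg _) (Real.rpow_nonneg hs.1 _)) hL1
  have hδ : ∀ᶠ δ in 𝓝[>] (0 : ℝ), L < Λ * ∫ s in δ..1, ψ s ^ 2 * s ^ (ν - 1) := by
    have hint := intervalIntegrable_sq_mul_rpow hν hψ.continuousOn
    have hc := intervalIntegral.continuousOn_primitive_interval_left (μ := volume) (a := 0) (b := 1)
      (by rw [Set.uIcc_of_le zero_le_one]
          exact (intervalIntegrable_iff_integrableOn_Icc_of_le zero_le_one).1 hint)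
    rw [Set.uIcc_of_le zero_le_one] at hc
    have h0 := (hc 0 (Set.left_mem_Icc.2 zero_le_one)).tendsto.mono_left
      (nhdsWithin_le_of_mem (Icc_mem_nhdsGT zero_lt_one))
    exact (h0.const_mul Λ).eventually (lt_mem_nhds hL2)
  have hμ : ∀ᶠ μ in 𝓝[<] ν, ∫ s in (0 : ℝ)..1, ψ' s ^ 2 * s ^ (μ - 1) < L := by
    suffices hlim : Tendsto (fun μ ↦ ∫ s in (0 : ℝ)..1, ψ' s ^ 2 * s ^ (μ - 1)) (𝓝[<] ν)
        (𝓝 (∫ s in (0 : ℝ)..1, ψ' s ^ 2 * s ^ (ν - 1))) from hlim.eventually (gt_mem_nhds hL1)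
    refine intervalIntegral.tendsto_integral_filter_of_dominated_convergence
      (fun s ↦ ψ' s ^ 2 * s ^ (ν / 2 - 1)) ?_ ?_
      (intervalIntegrable_sq_mul_rpow (half_pos hν) hψ'.continuousOn) ?_
    · refine Eventually.of_forall fun μ ↦ ?_
      refine Measurable.aestronglyMeasurable ?_
      have := hψ'.measurable
      fun_prop
    · filter_upwards [Ioo_mem_nhdsLT (half_lt_self hν)] with μ hμ
      refine Eventually.of_forall fun s hs ↦ ?_
      rw [Set.uIoc_of_le zero_le_one] at hs
      rw [Real.norm_of_nonneg (mul_nonneg (sq_nonneg _) (Real.rpow_nonneg hs.1.le _))]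
      exact mul_le_mul_of_nonneg_left (Real.rpow_le_rpow_of_exponent_ge hs.1 hs.2
        (by linarith [hμ.1])) (sq_nonneg _)
    · refine Eventually.of_forall fun s hs ↦ ?_
      rw [Set.uIoc_of_le zero_le_one] at hs
      have : ContinuousAt (fun μ : ℝ ↦ ψ' s ^ 2 * s ^ (μ - 1)) ν :=
        continuousAt_const.mul ((Real.continuous_const_rpow hs.1.ne').comp
          (continuous_id.sub continuous_const)).continuousAt
      exact this.tendsto.mono_left nhdsWithin_le_nhds
  obtain ⟨δ, hδL, hδ0⟩ := (hδ.and (Ioo_mem_nhdsGT zero_lt_one)).exists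
  obtain ⟨μ₀, hμL, hμ0⟩ := (hμ.and (Ioo_mem_nhdsLT hν)).exists
  refine ⟨δ, μ₀, L, hδ0.1, hδ0.2, hμ0.1, hμ0.2, hL0, hδL, fun μ hμ ↦ le_trans ?_ hμL.le⟩
  refine intervalIntegral.integral_mono_on_of_le_Ioo zero_le_one
    (intervalIntegrable_sq_mul_rpow (hμ0.1.trans_le hμ) hψ'.continuousOn)
    (intervalIntegrable_sq_mul_rpow hμ0.1 hψ'.continuousOn) fun s hs ↦ ?_
  exact mul_le_mul_of_nonneg_left (Real.rpow_le_rpow_of_exponent_ge hs.1 hs.2.le (by linarith))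
    (sq_nonneg _)

lemma exists_rpow_eq_one_div {δ q : ℝ} (hδ0 : 0 < δ) (hδ1 : δ < 1) (hq : 1 < q) :
    ∃ κ : ℝ, 0 < κ ∧ δ ^ κ = 1 / q := by
  have hlog : Real.log δ < 0 := Real.log_neg hδ0 hδ1
  refine ⟨Real.log q / -Real.log δ, div_pos (Real.log_pos hq) (neg_pos.2 hlog), ?_⟩
  rw [Real.rpow_def_of_pos hδ0, div_neg, mul_neg, mul_div_cancel₀ _ hlog.ne, Real.exp_neg,
    Real.exp_log (by linarith), one_div]

lemma exists_growth_of_integral_lt (m : Measure ℝ) (hneg : m (Set.Iio 0) = 0)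
    (hfin : ∀ R, m (Set.Iio R) ≠ ⊤) {ψ ψ' : ℝ → ℝ} (hψ : Continuous ψ) (hψ' : Continuous ψ')
    {ν Λ : ℝ} (hν : 0 < ν) (hΛ : 0 ≤ Λ)
    (hlt : ∫ s in (0 : ℝ)..1, ψ' s ^ 2 * s ^ (ν - 1) <
      Λ * ∫ s in (0 : ℝ)..1, ψ s ^ 2 * s ^ (ν - 1))
    (h : ∀ᶠ r in atTop,
      ENNReal.ofReal Λ * ∫⁻ t in Set.Iio r, ENNReal.ofReal (ψ (t / r) ^ 2) ∂m ≤
      ∫⁻ t in Set.Iio r, ENNReal.ofReal (ψ' (t / r) ^ 2) ∂m)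
    (hlow : ∀ β, β < ν → ∀ᶠ R in atTop, R ^ β ≤ (m (Set.Iio R)).toReal) :
    ∃ β c T : ℝ, ν < β ∧ 0 < c ∧ ∀ R, T ≤ R → c * R ^ β ≤ (m (Set.Iio R)).toReal := by
  -- Supplies the s-finiteness that Tonelli requires.
  have : IsLocallyFiniteMeasure m := ⟨fun x ↦
    ⟨Set.Iio (x + 1), Iio_mem_nhds (by linarith), (hfin _).lt_top⟩⟩
  obtain ⟨a, ha⟩ := eventually_atTop.1 (h.and (eventually_ge_atTop 1))
  have ha1 : 1 ≤ a := (ha a le_rfl).2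
  have ha0 : 0 < a := by linarith
  obtain ⟨δ, μ₀, K, hδ0, hδ1, hμ₀, hμ₀ν, hK, hKlt, hKge⟩ :=
    exists_truncation_of_integral_lt hν hψ hψ' hlt
  set θ := Λ * ∫ s in δ..1, ψ s ^ 2 * s ^ (ν - 1) with hθ
  have hq1 : 1 < θ / K := (one_lt_div hK).2 hKlt
  -- The midpoint between 1 and θ/K: the gap θ/K - q will absorb the additive constant of the
  -- recursion.
  set q := (1 + θ / K) / 2 with hq
  have hq1' : 1 < q := by linarith
  have hq2 : q < θ / K := by linarith
  obtain ⟨κ, hκ0, hδκ⟩ := exists_rpow_eq_one_div hδ0 hδ1 hq1'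
  -- κ depends only on δ and q, so μ can now be taken within κ/2 of ν, which makes μ + κ > ν.
  set μ := max μ₀ (ν - κ / 2) with hμ
  have hμ0 : 0 < μ := hμ₀.trans_le (le_max_left _ _)
  have hμν : μ < ν := max_lt hμ₀ν (by linarith)
  obtain ⟨C, hC, hrec⟩ := mellin_moment_recursion m hneg hψ hψ' hμ0 hμν.le hΛ ha0 hδ1
    fun r hr ↦ (ha r hr).1
  set V : ℝ → ℝ := fun R ↦ (m (Set.Iio R)).toReal with hV
  set f : ℝ → ℝ≥0∞ := fun R ↦ ∫⁻ t in Set.Ico a R, ENNReal.ofReal (t ^ (-μ)) ∂m with hf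
  have hmon : ∀ {x y t : ℝ}, 0 < x → x ≤ t → t ≤ y →
      y ^ (-μ) ≤ t ^ (-μ) ∧ t ^ (-μ) ≤ x ^ (-μ) := fun hx hxt hty ↦
    ⟨Real.rpow_le_rpow_of_nonpos (hx.trans_le hxt) hty (by linarith),
      Real.rpow_le_rpow_of_nonpos hx hxt (by linarith)⟩
  have hupper : ∀ x R, 0 < x → ∫⁻ t in Set.Ico x R, ENNReal.ofReal (t ^ (-μ)) ∂m ≤
      ENNReal.ofReal (x ^ (-μ)) * m (Set.Iio R) := fun x R hx ↦
    calc _ ≤ ∫⁻ _ in Set.Ico x R, ENNReal.ofReal (x ^ (-μ)) ∂m :=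
          setLIntegral_mono' measurableSet_Ico fun t ht ↦
            ENNReal.ofReal_le_ofReal (hmon hx ht.1 ht.2.le).2
      _ = ENNReal.ofReal (x ^ (-μ)) * m (Set.Ico x R) := setLIntegral_const _ _
      _ ≤ _ := mul_le_mul_right (measure_mono fun t ht ↦ ht.2) _
  have hffin : ∀ R, f R ≠ ⊤ := fun R ↦
    ne_top_of_le_ne_top (ENNReal.mul_ne_top ENNReal.ofReal_ne_top (hfin R)) (hupper a R ha0)
  set F : ℝ → ℝ := fun R ↦ (f R).toReal with hF
  have hFmono : Monotone F := fun x y hxy ↦ ENNReal.toReal_mono (hffin y)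
    (lintegral_mono_set (Set.Ico_subset_Ico_right hxy))
  set C₁ := (C * m (Set.Iio a)).toReal with hC₁
  have hrecF : ∀ R, a ≤ R → θ * F (δ * R) ≤ C₁ + K * F R := fun R hR ↦ by
    have h1 : ENNReal.ofReal θ * f (δ * R) ≤ C * m (Set.Iio a) + ENNReal.ofReal K * f R :=
      (hrec R hR).trans (by gcongr; exact hKge μ (le_max_left _ _))
    have h2 := ENNReal.toReal_mono (ENNReal.add_ne_top.2 ⟨ENNReal.mul_ne_top hC (hfin a),
      ENNReal.mul_ne_top ENNReal.ofReal_ne_top (hffin R)⟩) h1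
    rwa [ENNReal.toReal_add (ENNReal.mul_ne_top hC (hfin a))
      (ENNReal.mul_ne_top ENNReal.ofReal_ne_top (hffin R)), ENNReal.toReal_mul (a := ENNReal.ofReal θ),
      ENNReal.toReal_mul (a := ENNReal.ofReal K),
      ENNReal.toReal_ofReal hK.le, ENNReal.toReal_ofReal (hK.trans hKlt).le] at h2
  have hFlow : ∀ R, a ≤ R → R ^ (-μ) * (V R - V a) ≤ F R := fun R hR ↦ by
    have hR0 : 0 < R := ha0.trans_le hR
    have h1 : ENNReal.ofReal (R ^ (-μ)) * m (Set.Ico a R) ≤ f R := by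
      rw [← setLIntegral_const]
      exact setLIntegral_mono' measurableSet_Ico fun t ht ↦
        ENNReal.ofReal_le_ofReal (hmon ha0 ht.1 ht.2.le).1
    have h2 : m (Set.Iio R) ≤ m (Set.Iio a) + m (Set.Ico a R) := by
      rw [← Set.Iio_union_Ico_eq_Iio hR]
      exact measure_union_le _ _
    have h3 : m (Set.Ico a R) ≠ ⊤ := ne_top_of_le_ne_top (hfin R) (measure_mono fun t ht ↦ ht.2)
    have h4 := ENNReal.toReal_mono (hffin R) h1
    have h5 := ENNReal.toReal_mono (ENNReal.add_ne_top.2 ⟨hfin a, h3⟩) h2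
    rw [ENNReal.toReal_add (hfin a) h3] at h5
    rw [ENNReal.toReal_mul, ENNReal.toReal_ofReal (Real.rpow_nonneg hR0.le _)] at h4
    refine le_trans (mul_le_mul_of_nonneg_left ?_ (Real.rpow_nonneg hR0.le _)) h4
    simp only [hV]
    linarith
  -- Since μ < ν, the lower growth of V at the intermediate exponent (μ+ν)/2 beats the factor
  -- R^(-μ).
  have hFtop : Tendsto F atTop atTop := by
    have h1 : Tendsto (fun R : ℝ ↦ R ^ ((ν - μ) / 2) - V a) atTop atTop :=
      tendsto_atTop_add_const_right _ _ (tendsto_rpow_atTop (by linarith))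
    refine tendsto_atTop_mono' _ ?_ h1
    filter_upwards [eventually_ge_atTop a, hlow ((μ + ν) / 2) (by linarith)] with R hR hRV
    have hR0 : 0 < R := ha0.trans_le hR
    refine le_trans ?_ (hFlow R hR)
    have h2 : R ^ ((ν - μ) / 2) = R ^ (-μ) * R ^ ((μ + ν) / 2) := by
      rw [← Real.rpow_add hR0]; congr 1; ring
    have h3 : R ^ (-μ) ≤ 1 := Real.rpow_le_one_of_one_le_of_nonpos (ha1.trans hR) (by linarith)
    have h4 : 0 ≤ V a := ENNReal.toReal_nonneg
    have h5 : 0 ≤ R ^ (-μ) := Real.rpow_nonneg hR0.le _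
    rw [h2]
    nlinarith [mul_le_mul_of_nonneg_left hRV h5]
  obtain ⟨T₀, hT₀⟩ := eventually_atTop.1 ((hFtop.eventually_ge_atTop
    (max 1 (C₁ / K / (θ / K - q)))).and (eventually_ge_atTop a))
  have hT₀a : a ≤ T₀ := (hT₀ T₀ le_rfl).2
  have hT₀pos : 0 < T₀ := ha0.trans_le hT₀a
  have hT : T₀ ≤ T₀ / δ := by rw [le_div_iff₀ hδ0]; exact mul_le_of_le_one_right hT₀pos.le hδ1.le
  have hgain : ∀ R, T₀ / δ ≤ R → q * F (δ * R) ≤ F R := fun R hR ↦ by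
    have h1 : T₀ ≤ δ * R := by rw [div_le_iff₀ hδ0] at hR; linarith
    have h2 := (le_max_right _ _).trans (hT₀ _ h1).1
    rw [div_le_iff₀ (by linarith), div_le_iff₀ hK] at h2
    have h3 := hrecF R (hT₀a.trans (hT.trans hR))
    have h4 : θ = θ / K * K := (div_mul_cancel₀ _ hK.ne').symm
    refine le_of_mul_le_mul_left ?_ hK
    rw [h4] at h3
    linarith
  obtain ⟨c, hc, hgrow⟩ := exists_mul_rpow_le_of_iterate hFmono hδ0 hδ1 hκ0 (hT₀pos.trans_le hT)
    (lt_of_lt_of_le one_pos ((le_max_left _ _).trans (hT₀ _ hT).1)) fun R hR ↦ by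
      rw [hδκ, one_div, inv_mul_eq_div, le_div_iff₀ (by linarith), mul_comm]
      exact hgain R hR
  refine ⟨μ + κ, δ ^ μ * ((1 - 1 / q) * c), T₀ / δ, ?_, ?_, fun R hR ↦ ?_⟩
  · linarith [le_max_right μ₀ (ν - κ / 2)]
  · have : 1 / q < 1 := (div_lt_one (by linarith)).2 hq1'
    have := Real.rpow_pos_of_pos hδ0 μ
    have : 0 < 1 - 1 / q := by linarith
    positivity
  · have hR0 : 0 < R := hT₀pos.trans_le (hT.trans hR)
    have haδ : a ≤ δ * R := by rw [div_le_iff₀ hδ0] at hR; linarith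
    have hδR : 0 < δ * R := by positivity
    -- Back from F to V: at most the fraction 1/q of F(R) lies below δR, and on [δR, R) the weight
    -- is at most (δR)^(-μ).
    have h1 : F R ≤ F (δ * R) + (δ * R) ^ (-μ) * V R := by
      have h2 : f R ≤ f (δ * R) + ENNReal.ofReal ((δ * R) ^ (-μ)) * m (Set.Iio R) := by
        refine le_trans ?_ (add_le_add_right (hupper (δ * R) R hδR) _)
        refine le_trans ?_ (lintegral_union_le _ _ _)
        rw [Set.Ico_union_Ico_eq_Ico haδ (mul_le_of_le_one_left hR0.le hδ1.le)]
      have h3 := ENNReal.mul_ne_top (ENNReal.ofReal_ne_top (r := (δ * R) ^ (-μ))) (hfin R)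
      have h4 := ENNReal.toReal_mono (ENNReal.add_ne_top.2 ⟨hffin _, h3⟩) h2
      rwa [ENNReal.toReal_add (hffin _) h3, ENNReal.toReal_mul,
        ENNReal.toReal_ofReal (Real.rpow_nonneg hδR.le _)] at h4
    have h5 : F (δ * R) ≤ 1 / q * F R := by
      rw [one_div, inv_mul_eq_div, le_div_iff₀ (by linarith), mul_comm]
      exact hgain R hR
    have hq' : 0 < 1 - 1 / q := by
      have : 1 / q < 1 := (div_lt_one (by linarith)).2 hq1'
      linarith
    have h6 : (1 - 1 / q) * (c * R ^ κ) ≤ (δ * R) ^ (-μ) * V R :=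
      (mul_le_mul_of_nonneg_left (hgrow R hR) hq'.le).trans (by linarith)
    rw [Real.rpow_neg hδR.le, inv_mul_eq_div, le_div_iff₀ (Real.rpow_pos_of_pos hδR μ),
      Real.mul_rpow hδ0.le hR0.le] at h6
    rw [Real.rpow_add hR0]
    linarith

/-- On t < δR the mass density is at least (1-δ²)² and the energy density at most 4δ²; on the
remaining shell the energy density is at most 4. For small δ the shell must therefore carry a fixed
fraction of V(δR). -/
lemma exists_growth_of_pos (m : Measure ℝ) (hneg : m (Set.Iio 0) = 0)
    (hfin : ∀ R, m (Set.Iio R) ≠ ⊤) {Λ r₀ : ℝ} (hΛ : 0 < Λ) (hr₀ : 0 < m (Set.Iio r₀))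
    (h : ∀ᶠ r in atTop,
      ENNReal.ofReal Λ * ∫⁻ t in Set.Iio r, ENNReal.ofReal ((1 - (t / r) ^ 2) ^ 2) ∂m ≤
      ∫⁻ t in Set.Iio r, ENNReal.ofReal ((-(2 * (t / r))) ^ 2) ∂m) :
    ∃ β c T : ℝ, 0 < β ∧ 0 < c ∧ ∀ R, T ≤ R → c * R ^ β ≤ (m (Set.Iio R)).toReal := by
  set V : ℝ → ℝ := fun R ↦ (m (Set.Iio R)).toReal with hV
  obtain ⟨T, hT⟩ := eventually_atTop.1 (h.and (eventually_ge_atTop (max r₀ 1)))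
  have hT0 : 0 < T := one_pos.trans_le ((le_max_right _ _).trans (hT T le_rfl).2)
  have hVmono : Monotone V := fun x y hxy ↦
    ENNReal.toReal_mono (hfin y) (measure_mono (Set.Iio_subset_Iio hxy))
  have hVT : 0 < V T := lt_of_lt_of_le (ENNReal.toReal_pos hr₀.ne' (hfin r₀))
    (hVmono ((le_max_left _ _).trans (hT T le_rfl).2))
  obtain ⟨δ, hδpos, hδ0, hδ1⟩ : ∃ δ : ℝ, 0 < Λ * (1 - δ ^ 2) ^ 2 - 4 * δ ^ 2 ∧ 0 < δ ∧ δ < 1 := by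
    have hc : ContinuousAt (fun δ : ℝ ↦ Λ * (1 - δ ^ 2) ^ 2 - 4 * δ ^ 2) 0 := by fun_prop
    have := (hc.tendsto.mono_left (nhdsWithin_le_nhds (s := Set.Ioi 0))).eventually
      (lt_mem_nhds (show 0 < Λ * (1 - 0 ^ 2) ^ 2 - 4 * 0 ^ 2 by simpa using hΛ))
    exact (this.and (Ioo_mem_nhdsGT zero_lt_one)).exists
  set q := 1 + (Λ * (1 - δ ^ 2) ^ 2 - 4 * δ ^ 2) / 4 with hq
  have hq1 : 1 < q := by linarith
  obtain ⟨κ, hκ, hδκ⟩ := exists_rpow_eq_one_div hδ0 hδ1 hq1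
  obtain ⟨c, hc, hgrow⟩ := exists_mul_rpow_le_of_iterate hVmono hδ0 hδ1 hκ hT0 hVT fun R hR ↦ by
    have hR0 : 0 < R := hT0.trans_le hR
    have hδR : δ * R ≤ R := mul_le_of_le_one_left hR0.le hδ1.le
    have hae : ∀ᵐ t ∂m, 0 ≤ t := by
      filter_upwards [measure_eq_zero_iff_ae_notMem.1 hneg] with t ht using not_lt.1 ht
    have h1 : ENNReal.ofReal (Λ * (1 - δ ^ 2) ^ 2) * m (Set.Iio (δ * R)) ≤
        ENNReal.ofReal Λ * ∫⁻ t in Set.Iio R, ENNReal.ofReal ((1 - (t / R) ^ 2) ^ 2) ∂m := by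
      rw [ENNReal.ofReal_mul hΛ.le, mul_assoc, ← setLIntegral_const]
      refine mul_le_mul_right (le_trans (lintegral_mono_ae
        ((ae_restrict_iff' measurableSet_Iio).2 ?_))
        (lintegral_mono_set (Set.Iio_subset_Iio hδR))) _
      filter_upwards [hae] with t ht0 ht
      have ht1 : t / R ≤ δ := by rw [div_le_iff₀ hR0]; exact (Set.mem_Iio.1 ht).le
      have ht2 : (t / R) ^ 2 ≤ δ ^ 2 := pow_le_pow_left₀ (by positivity) ht1 2
      have hδ2 : δ ^ 2 ≤ 1 := pow_le_one₀ hδ0.le hδ1.le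
      exact ENNReal.ofReal_le_ofReal (pow_le_pow_left₀ (by linarith) (by linarith) 2)
    have h2 : ∫⁻ t in Set.Iio (δ * R), ENNReal.ofReal ((-(2 * (t / R))) ^ 2) ∂m ≤
        ENNReal.ofReal (4 * δ ^ 2) * m (Set.Iio (δ * R)) := by
      rw [← setLIntegral_const]
      refine lintegral_mono_ae ((ae_restrict_iff' measurableSet_Iio).2 ?_)
      filter_upwards [hae] with t ht0 ht
      have ht1 : t / R ≤ δ := by rw [div_le_iff₀ hR0]; exact (Set.mem_Iio.1 ht).le
      have ht2 : (t / R) ^ 2 ≤ δ ^ 2 := pow_le_pow_left₀ (by positivity) ht1 2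
      exact ENNReal.ofReal_le_ofReal (by nlinarith)
    have h3 : ∫⁻ t in Set.Ico (δ * R) R, ENNReal.ofReal ((-(2 * (t / R))) ^ 2) ∂m ≤
        ENNReal.ofReal 4 * m (Set.Ico (δ * R) R) := by
      rw [← setLIntegral_const]
      refine lintegral_mono_ae ((ae_restrict_iff' measurableSet_Ico).2 ?_)
      filter_upwards [hae] with t ht0 ht
      have ht1 : t / R ≤ 1 := by rw [div_le_one hR0]; exact ht.2.le
      have ht2 : (t / R) ^ 2 ≤ 1 := pow_le_one₀ (by positivity) ht1
      exact ENNReal.ofReal_le_ofReal (by nlinarith)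
    have hunion : Set.Iio R = Set.Iio (δ * R) ∪ Set.Ico (δ * R) R :=
      (Set.Iio_union_Ico_eq_Iio hδR).symm
    have h4 : ENNReal.ofReal (Λ * (1 - δ ^ 2) ^ 2) * m (Set.Iio (δ * R)) ≤
        ENNReal.ofReal (4 * δ ^ 2) * m (Set.Iio (δ * R)) +
          ENNReal.ofReal 4 * m (Set.Ico (δ * R) R) := by
      refine h1.trans ((hT R hR).1.trans ?_)
      rw [hunion]
      exact (lintegral_union_le _ _ _).trans (add_le_add h2 h3)
    have hW : m (Set.Ico (δ * R) R) ≠ ⊤ :=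
      ne_top_of_le_ne_top (hfin R) (measure_mono fun t ht ↦ ht.2)
    have h5 : V R = V (δ * R) + (m (Set.Ico (δ * R) R)).toReal := by
      simp only [hV]
      have hdisj : Disjoint (Set.Iio (δ * R)) (Set.Ico (δ * R) R) :=
        Set.disjoint_left.2 fun t h1 h2 ↦ absurd h2.1 (not_le.2 h1)
      rw [← ENNReal.toReal_add (hfin _) hW, ← measure_union hdisj measurableSet_Ico, ← hunion]
    have h6 := ENNReal.toReal_mono (ENNReal.add_ne_top.2
      ⟨ENNReal.mul_ne_top ENNReal.ofReal_ne_top (hfin _),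
        ENNReal.mul_ne_top ENNReal.ofReal_ne_top hW⟩) h4
    rw [ENNReal.toReal_add (ENNReal.mul_ne_top ENNReal.ofReal_ne_top (hfin _))
      (ENNReal.mul_ne_top ENNReal.ofReal_ne_top hW), ENNReal.toReal_mul, ENNReal.toReal_mul,
      ENNReal.toReal_mul, ENNReal.toReal_ofReal (by positivity),
      ENNReal.toReal_ofReal (by positivity), ENNReal.toReal_ofReal (by positivity)] at h6
    rw [hδκ, one_div, inv_mul_eq_div, le_div_iff₀ (by linarith), hq]
    simp only [hV] at h5 ⊢
    linarith
  exact ⟨κ, c, T, hκ, hc, hgrow⟩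

/-! ### Logarithmic growth rates. -/

lemma le_log_div_log_iff {v : ℝ≥0∞} {β r : ℝ} (hr : 1 < r) :
    (β : EReal) ≤ ENNReal.log v / ((Real.log r : ℝ) : EReal) ↔ ENNReal.ofReal (r ^ β) ≤ v := by
  have hr0 : 0 < r := by linarith
  have hlog : (0 : EReal) < ((Real.log r : ℝ) : EReal) := by exact_mod_cast Real.log_pos hr
  rw [EReal.le_div_iff_mul_le hlog (EReal.coe_ne_top _), ← EReal.coe_mul, ← Real.log_rpow hr0,
    ← ENNReal.log_ofReal_of_pos (Real.rpow_pos_of_pos hr0 β), ENNReal.log_le_log_iff]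

section Growth

variable {v : ℝ → ℝ≥0∞}

lemma le_liminf_log_div_log {β : ℝ} (h : ∀ᶠ r in atTop, ENNReal.ofReal (r ^ β) ≤ v r) :
    (β : EReal) ≤ liminf (fun r : ℝ ↦ ENNReal.log (v r) / ((Real.log r : ℝ) : EReal)) atTop := by
  refine le_liminf_of_le (by isBoundedDefault) ?_
  filter_upwards [h, eventually_gt_atTop 1] with r hr hr1 using (le_log_div_log_iff hr1).2 hr

lemma eventually_rpow_le_of_lt_liminf {β : ℝ}
    (h : (β : EReal) < liminf (fun r : ℝ ↦ ENNReal.log (v r) / ((Real.log r : ℝ) : EReal)) atTop) :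
    ∀ᶠ r in atTop, ENNReal.ofReal (r ^ β) ≤ v r := by
  filter_upwards [eventually_lt_of_lt_liminf h, eventually_gt_atTop 1] with r hr hr1
    using (le_log_div_log_iff hr1).1 hr.le

lemma liminf_log_div_log_nonneg (hv : Monotone v) {r₀ : ℝ} (hr₀ : 0 < v r₀) :
    0 ≤ liminf (fun r : ℝ ↦ ENNReal.log (v r) / ((Real.log r : ℝ) : EReal)) atTop := by
  refine EReal.ge_of_forall_gt_iff_ge.1 fun β hβ ↦ le_liminf_log_div_log ?_
  have hβ0 : 0 < -β := neg_pos.2 (by exact_mod_cast hβ)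
  have hlim : Tendsto (fun r : ℝ ↦ ENNReal.ofReal (r ^ β)) atTop (𝓝 0) := by
    have := ENNReal.tendsto_ofReal (tendsto_rpow_neg_atTop hβ0)
    simpa using this
  filter_upwards [hlim.eventually (gt_mem_nhds hr₀), eventually_ge_atTop r₀] with r hr hr'
    using hr.le.trans (hv hr')

/-- One infinite value propagates to all larger radii and forces an infinite rate. Finiteness of the
|B_r| is thus drawn from ν_* < ∞ rather than from compactness. -/
lemma ne_top_of_liminf_log_div_log_ne_top (hv : Monotone v)
    (h : liminf (fun r : ℝ ↦ ENNReal.log (v r) / ((Real.log r : ℝ) : EReal)) atTop ≠ ⊤) (r : ℝ) :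
    v r ≠ ⊤ := fun hr ↦ by
  refine h (EReal.eq_top_iff_forall_lt _ |>.2 fun β ↦ ?_)
  refine lt_of_lt_of_le (EReal.coe_lt_coe_iff.2 (lt_add_one β)) (le_liminf_log_div_log ?_)
  filter_upwards [eventually_ge_atTop r] with s hs
  rw [eq_top_mono (hv hs) hr]
  exact le_top

/-- An exponent γ strictly between ν and β absorbs the constant c. -/
lemma lt_liminf_log_div_log_of_mul_rpow_le (hv : ∀ r, v r ≠ ⊤) {ν β c T : ℝ} (hβ : ν < β)
    (hc : 0 < c) (h : ∀ r, T ≤ r → c * r ^ β ≤ (v r).toReal) :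
    (ν : EReal) < liminf (fun r : ℝ ↦ ENNReal.log (v r) / ((Real.log r : ℝ) : EReal)) atTop := by
  obtain ⟨γ, hγ1, hγ2⟩ := exists_between hβ
  refine lt_of_lt_of_le (EReal.coe_lt_coe_iff.2 hγ1) (le_liminf_log_div_log ?_)
  filter_upwards [eventually_ge_atTop T, eventually_gt_atTop 0,
    (tendsto_rpow_atTop (sub_pos.2 hγ2)).eventually_ge_atTop (1 / c)] with r hr hr0 hr1
  rw [ENNReal.ofReal_le_iff_le_toReal (hv r)]
  refine le_trans ?_ (h r hr)
  rw [div_le_iff₀ hc] at hr1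
  calc r ^ γ = 1 * r ^ γ := (one_mul _).symm
    _ ≤ r ^ (β - γ) * c * r ^ γ := mul_le_mul_of_nonneg_right hr1 (Real.rpow_nonneg hr0.le _)
    _ = c * r ^ β := by rw [mul_comm _ c, mul_assoc, ← Real.rpow_add hr0, sub_add_cancel]

end Growth

/-! ### Transfer to the half-line and the main theorem. -/

section Main

variable (E : Type*) [NormedAddCommGroup E] [InnerProductSpace ℝ E] [FiniteDimensional ℝ E]
  [MeasurableSpace E] [BorelSpace E]
  {M : Type*} [EMetricSpace M] [ChartedSpace E M]
  [RiemannianBundle (fun x : M ↦ TangentSpace 𝓘(ℝ, E) x)] [MeasurableSpace M]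

lemma monotone_riemannianVolume_sublevel (ρ : M → ℝ) :
    Monotone fun r ↦ riemannianVolume E M {x | ρ x < r} :=
  fun _ _ hrs ↦ measure_mono fun _ hx ↦ lt_of_lt_of_le hx hrs

/-- The distribution of `ρ` with respect to the Riemannian volume. -/
noncomputable def radialMeasure (ρ : M → ℝ) : Measure ℝ :=
  (riemannianVolume E M).map ρ

variable [BorelSpace M]

lemma radialMeasure_Iio {ρ : M → ℝ} (hρ : Continuous ρ) (r : ℝ) :
    radialMeasure E ρ (Set.Iio r) = riemannianVolume E M {x | ρ x < r} :=
  Measure.map_apply hρ.measurable measurableSet_Iio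

lemma setLIntegral_radialMeasure {ρ : M → ℝ} (hρ : Continuous ρ) (r : ℝ) {f : ℝ → ℝ≥0∞}
    (hf : Measurable f) :
    ∫⁻ t in Set.Iio r, f t ∂(radialMeasure E ρ) =
      ∫⁻ x in {x | ρ x < r}, f (ρ x) ∂(riemannianVolume E M) :=
  setLIntegral_map measurableSet_Iio hf hρ.measurable

variable [IsManifold 𝓘(ℝ, E) ∞ M]
  [IsContMDiffRiemannianBundle 𝓘(ℝ, E) ∞ E (fun x : M ↦ TangentSpace 𝓘(ℝ, E) x)]

lemma exists_riemannianVolume_sublevel_pos [Nonempty M] {ρ : M → ℝ} (hρ : Continuous ρ) :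
    ∃ r, 0 < riemannianVolume E M {x | ρ x < r} := by
  obtain ⟨x⟩ := ‹Nonempty M›
  exact ⟨ρ x + 1, riemannianVolume_pos E (isOpen_lt hρ continuous_const)
    ⟨x, by simp⟩⟩

lemma nuStar_nonneg [Nonempty M] {ρ : M → ℝ} (hρ : IsLipschitzExhaustion E ρ) :
    0 ≤ nuStar E ρ := by
  obtain ⟨r, hr⟩ := exists_riemannianVolume_sublevel_pos E hρ.locallyLipschitz.continuous
  exact liminf_log_div_log_nonneg (monotone_riemannianVolume_sublevel E ρ) hr

variable [IsRiemannianManifold 𝓘(ℝ, E) M]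

lemma eventually_radialMeasure_energy_le {ρ : M → ℝ} (hρ : IsLipschitzExhaustion E ρ) {Λ : ℝ}
    (hΛ : ENNReal.ofReal Λ < LambdaStar E ρ) {ψ : ℝ → ℝ} (hψ : ContDiff ℝ 1 ψ) (hψ1 : ψ 1 = 0) :
    ∀ᶠ r in atTop, ENNReal.ofReal Λ *
        ∫⁻ t in Set.Iio r, ENNReal.ofReal (ψ (t / r) ^ 2) ∂(radialMeasure E ρ) ≤
      ∫⁻ t in Set.Iio r, ENNReal.ofReal (deriv ψ (t / r) ^ 2) ∂(radialMeasure E ρ) := by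
  have hcont := hρ.locallyLipschitz.continuous
  have hm := hψ.continuous.measurable
  have hm' := measurable_deriv ψ
  filter_upwards [eventually_lt_of_lt_liminf hΛ, eventually_gt_atTop 0] with r hr hr0
  rw [setLIntegral_radialMeasure E hcont r (by fun_prop),
    setLIntegral_radialMeasure E hcont r (by fun_prop)]
  exact (mul_le_mul_left hr.le _).trans (dirichletEigenvalue_mul_lintegral_le E hρ hψ hψ1 hr0)

lemma LambdaStar_eq_zero [Nonempty M] {ρ : M → ℝ} (hρ : IsLipschitzExhaustion E ρ)
    (hν : nuStar E ρ = 0) : LambdaStar E ρ = 0 := by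
  have hcont := hρ.locallyLipschitz.continuous
  have hfin := ne_top_of_liminf_log_div_log_ne_top (monotone_riemannianVolume_sublevel E ρ)
    (show nuStar E ρ ≠ ⊤ by simp [hν])
  by_contra hne
  obtain ⟨Λ, hΛ0, hΛ1, hΛ2⟩ := ENNReal.lt_iff_exists_real_btwn.1 (pos_iff_ne_zero.2 hne)
  obtain ⟨r₀, hr₀⟩ := exists_riemannianVolume_sublevel_pos E hcont
  have hd : ∀ s : ℝ, deriv (fun s : ℝ ↦ 1 - s ^ 2) s = -(2 * s) := fun s ↦
    (((hasDerivAt_id s).pow 2).const_sub 1 |>.congr_deriv (by simp)).deriv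
  have hen := eventually_radialMeasure_energy_le E hρ hΛ2 (ψ := fun s ↦ 1 - s ^ 2)
    (by fun_prop) (by simp)
  simp only [hd] at hen
  obtain ⟨β, c, T, hβ, hc, hT⟩ := exists_growth_of_pos (radialMeasure E ρ)
    (by rw [radialMeasure_Iio E hcont]; simp [not_lt.2 (hρ.nonneg _)])
    (fun R ↦ by rw [radialMeasure_Iio E hcont]; exact hfin R) (ENNReal.ofReal_pos.1 hΛ1)
    (by rwa [radialMeasure_Iio E hcont]) hen
  simp only [radialMeasure_Iio E hcont] at hT
  exact (lt_liminf_log_div_log_of_mul_rpow_le hfin hβ hc hT).ne' hν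

lemma LambdaStar_le_radialEigenvalue {ρ : M → ℝ} (hρ : IsLipschitzExhaustion E ρ) {ν : ℝ}
    (hν0 : 0 < ν) (hν : nuStar E ρ = ν) : LambdaStar E ρ ≤ radialEigenvalue ν := by
  have hcont := hρ.locallyLipschitz.continuous
  have hfin := ne_top_of_liminf_log_div_log_ne_top (monotone_riemannianVolume_sublevel E ρ)
    (show nuStar E ρ ≠ ⊤ by simp [hν])
  rw [radialEigenvalue_eq hν0]
  -- Testing with the extremal itself makes the energy inequality strict for every Λ > j².
  set j := besselFirstZero (ν / 2 - 1)
  by_contra! hlt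
  obtain ⟨Λ, hΛ0, hΛ1, hΛ2⟩ := ENNReal.lt_iff_exists_real_btwn.1 hlt
  have hjΛ : j ^ 2 < Λ := (ENNReal.ofReal_lt_ofReal_iff_of_nonneg (sq_nonneg j)).1 hΛ1
  have hψ := contDiff_besselRadial hν0 j
  have hj1 : besselRadial ν j 1 = 0 := besselRadial_besselFirstZero hν0
  have hψ' : Continuous (deriv (besselRadial ν j)) := hψ.continuous_deriv le_rfl
  have hpos : 0 < ∫ s in (0 : ℝ)..1, besselRadial ν j s ^ 2 * s ^ (ν - 1) := by
    have := setLIntegral_sq_mul_rpow_ne_zero ν hψ.continuous.continuousOn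
      ⟨0, Set.left_mem_Icc.2 zero_le_one, (besselRadial_zero_pos hν0 j).ne'⟩
    rw [setLIntegral_sq_mul_rpow hν0 hψ.continuous.continuousOn] at this
    exact ENNReal.ofReal_pos.1 (pos_iff_ne_zero.2 this)
  have henergy : ∫ s in (0 : ℝ)..1, deriv (besselRadial ν j) s ^ 2 * s ^ (ν - 1) <
      Λ * ∫ s in (0 : ℝ)..1, besselRadial ν j s ^ 2 * s ^ (ν - 1) := by
    rw [integral_deriv_sq_mul_rpow_eq hν0 hψ.continuous hψ'
      (continuous_besselRadial_primitive hν0 j).continuousOn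
      (fun s hs ↦ hasDerivAt_besselRadial_primitive hν0 j hs.1)
      (by simp [hj1, Real.zero_rpow hν0.ne'])]
    exact mul_lt_mul_of_pos_right hjΛ hpos
  obtain ⟨β, c, T, hβ, hc, hT⟩ := exists_growth_of_integral_lt (radialMeasure E ρ)
    (by rw [radialMeasure_Iio E hcont]; simp [not_lt.2 (hρ.nonneg _)])
    (fun R ↦ by rw [radialMeasure_Iio E hcont]; exact hfin R) hψ.continuous hψ' hν0 hΛ0 henergy
    (eventually_radialMeasure_energy_le E hρ hΛ2 hψ hj1)
    (fun β hβ ↦ by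
      filter_upwards [eventually_rpow_le_of_lt_liminf (v := fun r ↦ riemannianVolume E M {x | ρ x < r})
        (β := β) (by change _ < nuStar E ρ; rw [hν]; exact_mod_cast hβ)] with R hR
      rw [radialMeasure_Iio E hcont]
      exact (ENNReal.ofReal_le_iff_le_toReal (hfin R)).1 hR)
  simp only [radialMeasure_Iio E hcont] at hT
  exact (lt_liminf_log_div_log_of_mul_rpow_le hfin hβ hc hT).ne' hν

end Main

theorem corollary1p3 :
    ∃ ε N C₁ C₂ : ℝ, 0 < ε ∧ 0 < N ∧ 0 < C₁ ∧ 0 < C₂ ∧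
      ∀ (E : Type*) [NormedAddCommGroup E] [InnerProductSpace ℝ E] [FiniteDimensional ℝ E]
        [MeasurableSpace E] [BorelSpace E] (_ : 2 ≤ Module.finrank ℝ E)
        (M : Type*) [EMetricSpace M] [CompleteSpace M] [NoncompactSpace M]
        [ChartedSpace E M] [IsManifold 𝓘(ℝ, E) ∞ M]
        [RiemannianBundle (fun x : M ↦ TangentSpace 𝓘(ℝ, E) x)]
        [IsContMDiffRiemannianBundle 𝓘(ℝ, E) ∞ E (fun x : M ↦ TangentSpace 𝓘(ℝ, E) x)]
        [IsRiemannianManifold 𝓘(ℝ, E) M] [MeasurableSpace M] [BorelSpace M]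
        (ρ : M → ℝ) (_ : IsLipschitzExhaustion E ρ),
        0 ≤ nuStar E ρ ∧
        ∀ ν : ℝ, nuStar E ρ = (ν : EReal) →
          LambdaStar E ρ ≤ radialEigenvalue ν ∧
          (0 < ν →
            IsLeast {t : ℝ | 0 < t ∧ besselJ (ν / 2 - 1) t = 0} (besselFirstZero (ν / 2 - 1)) ∧
            radialEigenvalue ν = ENNReal.ofReal (besselFirstZero (ν / 2 - 1) ^ 2)) ∧
          (ν = 0 → LambdaStar E ρ = 0) ∧
          (0 < ν → ν < ε → LambdaStar E ρ ≤ ENNReal.ofReal (C₁ * ν)) ∧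
          (N < ν → LambdaStar E ρ ≤ ENNReal.ofReal (C₂ * ν ^ 2)) := by
  -- ν(ν+4)/2 is at most 5ν/2 when ν ≤ 1 and at most 5ν²/2 when ν ≥ 1.
  refine ⟨1, 1, 5 / 2, 5 / 2, by norm_num, by norm_num, by norm_num, by norm_num, ?_⟩
  intro E _ _ _ _ _ _ M _ _ _ _ _ _ _ _ _ _ ρ hρ
  have : Nonempty M := by
    by_contra hc
    rw [not_nonempty_iff] at hc
    exact not_compactSpace_iff.2 ‹NoncompactSpace M› inferInstance
  refine ⟨nuStar_nonneg E hρ, fun ν hν ↦ ?_⟩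
  have hν0 : 0 ≤ ν := by
    have := nuStar_nonneg E hρ
    rw [hν] at this
    exact_mod_cast this
  have hzero : ν = 0 → LambdaStar E ρ = 0 := fun h ↦ LambdaStar_eq_zero E hρ (by rw [hν, h]; rfl)
  have hquad : 0 < ν → LambdaStar E ρ ≤ ENNReal.ofReal (ν * (ν + 4) / 2) := fun h ↦
    (LambdaStar_le_radialEigenvalue E hρ h hν).trans (radialEigenvalue_le_quadratic h)
  refine ⟨?_, fun h ↦ ⟨isLeast_besselFirstZero h, radialEigenvalue_eq h⟩, hzero,
    fun h h1 ↦ (hquad h).trans (ENNReal.ofReal_le_ofReal (by nlinarith)),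
    fun h ↦ (hquad (by linarith)).trans (ENNReal.ofReal_le_ofReal (by nlinarith))⟩
  rcases hν0.eq_or_lt with h | h
  · rw [hzero h.symm]
    exact zero_le
  · exact LambdaStar_le_radialEigenvalue E hρ h hν
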